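/- **Theorem 2.2.** Let $(V,h)$ be a 3-dimensional Euclidean vector space, $S$ an endomorphism of $V$ that is symmetric with respect to $h$, and $K\colon V\times V\to V$ a bilinear map such that the trilinear form $h(K(X,Y),Z)$ is totally symmetric and $\operatorname{trace}K_X=0$ for all $X\in V$, where $K_X=K(X,\cdot)$. Let $$G=\{g\in SO(V):\ K(gX,gY)=gK(X,Y),\ S(gX)=gS(X)\ \text{for all }X,Y\in V\}$$ be the stabilizer of the pair $(K,S)$ in the group $SO(V)\cong SO(3)$ of linear isometries of determinant one. For an orthonormal basis $(e_1,e_2,e_3)$, denote by $P_i$ and $R_i$ the rotations about $e_i$ by the angles $\pi$ and $2\pi/3$, and by $Q$ the rotation by $2\pi/3$ with $e_1\mapsto e_2\mapsto e_3\mapsto e_1$. If $G$ is nontrivial, then $G$ is isomorphic to $SO(3)$, $O(2)=SO(2)\rtimes Z_2$, $SO(2)$, $A_4$, $S_3$, $Z_2\times Z_2$, $Z_3$ or $Z_2$, and there is an orthonormal basis $(e_1,e_2,e_3)$ of $V$ with respect to which $K$ and $S$ have one of the forms (i)–(viii) below, with real parameters. Conversely, whenever $K$ and $S$ have one of these forms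 with respect to some orthonormal basis, $G$ is exactly the group stated there. (i) $K=0$, $S=aI$; $\;G=SO(V)\cong SO(3)$. (ii) $K=0$, $S=\begin{pmatrix}a&0&0\\0&b&0\\0&0&b\end{pmatrix}$, $a\ne b$; $\;G$ is generated by all rotations about $e_1$ and $P_2$, and $G\cong O(2)$. (iii) $K_{e_1}=\begin{pmatrix}2\lambda&0&0\\0&-\lambda&0\\0&0&-\lambda\end{pmatrix}$, $K_{e_2}=\begin{pmatrix}0&-\lambda&0\\-\lambda&0&0\\0&0&0\end{pmatrix}$, $K_{e_3}=\begin{pmatrix}0&0&-\lambda\\0&0&0\\-\lambda&0&0\end{pmatrix}$, $S=\begin{pmatrix}a&0&0\\0&b&0\\0&0&b\end{pmatrix}$, $\lambda>0$; $\;G$ consists of all rotations about $e_1$, and $G\cong SO(2)$. (iv) $K_{e_1}=\begin{pmatrix}0&0&0\\0&0&\lambda\\0&\lambda&0\end{pmatrix}$, $K_{e_2}=\begin{pmatrix}0&0&\lambda\\0&0&0\\\lambda&0&0\end{pmatrix}$, $K_{e_3}=\begin{pmatrix}0&\lambda&0\\\lambda&0&0\\0&0&0\end{pmatrix}$, $S=aI$,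 $\lambda>0$; $\;G=\langle P_1,P_2,Q\rangle\cong A_4$. (v) $K_{e_1}=\begin{pmatrix}\lambda&0&0\\0&-\lambda&0\\0&0&0\end{pmatrix}$, $K_{e_2}=\begin{pmatrix}0&-\lambda&0\\-\lambda&0&0\\0&0&0\end{pmatrix}$, $K_{e_3}=0$, $S=\begin{pmatrix}a&0&0\\0&a&0\\0&0&b\end{pmatrix}$, $\lambda>0$; $\;G=\langle P_1,R_3\rangle\cong S_3$. (vi) $K_{e_1},K_{e_2},K_{e_3}$ as in (iv), but with $\lambda\ge 0$, and $S=\begin{pmatrix}a&0&0\\0&b&0\\0&0&c\end{pmatrix}$, where either $\lambda>0$ and $a,b,c$ are not all equal, or $\lambda=0$ and $a,b,c$ are pairwise distinct; $\;G=\langle P_1,P_2\rangle\cong Z_2\times Z_2$. (vii) $K_{e_1}=\begin{pmatrix}2\lambda&0&0\\0&-\lambda&0\\0&0&-\lambda\end{pmatrix}$, $K_{e_2}=\begin{pmatrix}0&-\lambda&0\\-\lambda&\mu&0\\0&0&-\mu\end{pmatrix}$, $K_{e_3}=\begin{pmatrix}0&0&-\lambda\\0&0&-\mu\\-\lambda&-\mu&0\end{pmatrix}$,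 $S=\begin{pmatrix}a&0&0\\0&b&0\\0&0&b\end{pmatrix}$, where either $\lambda>0$, $\mu>0$ and $\mu\ne\sqrt2\,\lambda$, or $\mu=\sqrt2\,\lambda>0$ and $a\ne b$; $\;G=\langle R_1\rangle\cong Z_3$. (viii) $K_{e_1}=\begin{pmatrix}2\lambda&0&0\\0&-\lambda&\mu\\0&\mu&-\lambda\end{pmatrix}$, $K_{e_2}=\begin{pmatrix}0&-\lambda&\mu\\-\lambda&0&0\\\mu&0&0\end{pmatrix}$, $K_{e_3}=\begin{pmatrix}0&\mu&-\lambda\\\mu&0&0\\-\lambda&0&0\end{pmatrix}$, $S=\begin{pmatrix}a&0&0\\0&b&d\\0&d&c\end{pmatrix}$, where either $\lambda>0$, $\mu>0$ and $\lambda\ne\mu$; or $\lambda=\mu>0$ and $(b-c)^2+(b+c-2a-2d)^2\ne0$; or $\lambda=0$, $\mu>0$ and $d\ne0$; or $\mu=0$, $\lambda>0$ and $(b-c)^2+d^2\ne0$; $\;G=\langle P_1\rangle\cong Z_2$. -/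

import Mathlib

open scoped Real InnerProductSpace

namespace CubicShape

variable {V : Type*} [NormedAddCommGroup V] [InnerProductSpace ℝ V]

/-- A symmetric `(2,1)`-form: the trilinear form `h(K(X,Y),Z)` is totally symmetric. -/
def IsSymmetricForm (K : V →ₗ[ℝ] V →ₗ[ℝ] V) : Prop :=
  (∀ X Y : V, K X Y = K Y X) ∧ ∀ X Y Z : V, ⟪K X Y, Z⟫_ℝ = ⟪K X Z, Y⟫_ℝ

/-- Apolarity: `trace K_X = 0` for every `X`. -/
def IsApolar (K : V →ₗ[ℝ] V →ₗ[ℝ] V) : Prop :=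
  ∀ X : V, LinearMap.trace ℝ V (K X) = 0

/-- The group `SO(V)` of linear isometries of determinant one. -/
noncomputable def rotationGroup (V : Type*) [NormedAddCommGroup V] [InnerProductSpace ℝ V] :
    Subgroup (V ≃ₗᵢ[ℝ] V) where
  carrier := {g | LinearEquiv.det g.toLinearEquiv = 1}
  one_mem' := map_one (LinearEquiv.det (R := ℝ) (M := V))
  mul_mem' := by
    intro a b ha hb
    have h : LinearEquiv.det (a * b).toLinearEquiv
        = LinearEquiv.det a.toLinearEquiv * LinearEquiv.det b.toLinearEquiv :=
      map_mul LinearEquiv.det a.toLinearEquiv b.toLinearEquiv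
    simp only [Set.mem_ofPred_eq] at ha hb ⊢
    rw [h, ha, hb, one_mul]
  inv_mem' := by
    intro a ha
    have h : LinearEquiv.det (a⁻¹).toLinearEquiv = (LinearEquiv.det a.toLinearEquiv)⁻¹ :=
      map_inv LinearEquiv.det a.toLinearEquiv
    simp only [Set.mem_ofPred_eq] at ha ⊢
    rw [h, ha, inv_one]

/-- The stabilizer in `SO(V)` of the pair `(K, S)`. -/
noncomputable def pairStabilizer (K : V →ₗ[ℝ] V →ₗ[ℝ] V) (S : V →ₗ[ℝ] V) :
    Subgroup (V ≃ₗᵢ[ℝ] V) where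
  carrier := {g | g ∈ rotationGroup V ∧ (∀ X Y : V, K (g X) (g Y) = g (K X Y)) ∧
    ∀ X : V, S (g X) = g (S X)}
  one_mem' := ⟨one_mem _, fun _ _ => rfl, fun _ => rfl⟩
  mul_mem' := by
    rintro a b ⟨ha, haK, haS⟩ ⟨hb, hbK, hbS⟩
    refine ⟨mul_mem ha hb, fun X Y => ?_, fun X => ?_⟩
    · simp only [LinearIsometryEquiv.coe_mul, Function.comp_apply, haK, hbK]
    · simp only [LinearIsometryEquiv.coe_mul, Function.comp_apply, haS, hbS]
  inv_mem' := by
    rintro a ⟨ha, haK, haS⟩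
    refine ⟨inv_mem ha, fun X Y => ?_, fun X => ?_⟩
    · apply a.injective
      rw [← haK]
      simp only [LinearIsometryEquiv.coe_inv, LinearIsometryEquiv.apply_symm_apply]
    · apply a.injective
      rw [← haS]
      simp only [LinearIsometryEquiv.coe_inv, LinearIsometryEquiv.apply_symm_apply]

/-- The image of the frame `e` under the rotation by the angle `θ` about `e i`
(indices modulo three). -/
noncomputable def rotatedFrame (e : OrthonormalBasis (Fin 3) ℝ V) (i : Fin 3) (θ : ℝ) :
    Fin 3 → V := fun j =>
  if j = i then e i
  else if j = i + 1 then Real.cos θ • e (i + 1) + Real.sin θ • e (i + 2)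
  else -(Real.sin θ • e (i + 1)) + Real.cos θ • e (i + 2)

theorem orthonormal_rotatedFrame (e : OrthonormalBasis (Fin 3) ℝ V) (i : Fin 3) (θ : ℝ) :
    Orthonormal ℝ (rotatedFrame e i θ) := by
  have he := fun a b => orthonormal_iff_ite.1 e.orthonormal a b
  have hc := Real.cos_sq_add_sin_sq θ
  rw [orthonormal_iff_ite]
  intro j k
  fin_cases i <;> fin_cases j <;> fin_cases k <;>
    simp [rotatedFrame, inner_add_left, inner_add_right, inner_smul_left, inner_smul_right, he,
      -inner_self_eq_norm_sq_to_K] <;>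
    linarith

/-- The orthonormal basis obtained from `e` by the rotation by `θ` about `e i`. -/
noncomputable def rotatedBasis (e : OrthonormalBasis (Fin 3) ℝ V) (i : Fin 3) (θ : ℝ) :
    OrthonormalBasis (Fin 3) ℝ V :=
  OrthonormalBasis.mk (orthonormal_rotatedFrame e i θ)
    ((orthonormal_rotatedFrame e i θ).linearIndependent.span_eq_top_of_card_eq_finrank
      (Module.finrank_eq_card_basis e.toBasis).symm).ge

/-- The rotation by the angle `θ` about the axis spanned by `e i`. -/
noncomputable def axisRotation (e : OrthonormalBasis (Fin 3) ℝ V) (i : Fin 3) (θ : ℝ) :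
    V ≃ₗᵢ[ℝ] V :=
  e.equiv (rotatedBasis e i θ) (Equiv.refl (Fin 3))

/-- `P_i`: the rotation by `π` about `e i`. -/
noncomputable def halfTurn (e : OrthonormalBasis (Fin 3) ℝ V) (i : Fin 3) : V ≃ₗᵢ[ℝ] V :=
  axisRotation e i π

/-- `R_i`: the rotation by `2π/3` about `e i`. -/
noncomputable def thirdTurn (e : OrthonormalBasis (Fin 3) ℝ V) (i : Fin 3) : V ≃ₗᵢ[ℝ] V :=
  axisRotation e i (2 * π / 3)

/-- `Q`: the rotation by `2π/3` about the line `x = y = z`; it permutes the basis vectors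
cyclically, `e 0 ↦ e 1 ↦ e 2 ↦ e 0`. -/
noncomputable def diagonalTurn (e : OrthonormalBasis (Fin 3) ℝ V) : V ≃ₗᵢ[ℝ] V :=
  e.equiv e (finRotate 3)

/-- With respect to the basis `e = (e₁, e₂, e₃)`, the endomorphisms `K_{e₁}`, `K_{e₂}`, `K_{e₃}`
and `S` have the given matrices. -/
def HasMatrices (e : OrthonormalBasis (Fin 3) ℝ V) (K : V →ₗ[ℝ] V →ₗ[ℝ] V) (S : V →ₗ[ℝ] V)
    (K₁ K₂ K₃ T : Matrix (Fin 3) (Fin 3) ℝ) : Prop :=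
  LinearMap.toMatrix e.toBasis e.toBasis (K (e 0)) = K₁ ∧
  LinearMap.toMatrix e.toBasis e.toBasis (K (e 1)) = K₂ ∧
  LinearMap.toMatrix e.toBasis e.toBasis (K (e 2)) = K₃ ∧
  LinearMap.toMatrix e.toBasis e.toBasis S = T

/-- Canonical form with symmetry group `SO(3)`. -/
def FormI (e : OrthonormalBasis (Fin 3) ℝ V) (K : V →ₗ[ℝ] V →ₗ[ℝ] V) (S : V →ₗ[ℝ] V) : Prop :=
  ∃ a : ℝ, HasMatrices e K S 0 0 0 !![a, 0, 0; 0, a, 0; 0, 0, a]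

/-- Canonical form with symmetry group generated by the rotations about `e₁` and `P₂`. -/
def FormII (e : OrthonormalBasis (Fin 3) ℝ V) (K : V →ₗ[ℝ] V →ₗ[ℝ] V) (S : V →ₗ[ℝ] V) : Prop :=
  ∃ a b : ℝ, a ≠ b ∧ HasMatrices e K S 0 0 0 !![a, 0, 0; 0, b, 0; 0, 0, b]

/-- Canonical form with symmetry group `SO(2)`. -/
def FormIII (e : OrthonormalBasis (Fin 3) ℝ V) (K : V →ₗ[ℝ] V →ₗ[ℝ] V) (S : V →ₗ[ℝ] V) : Prop :=
  ∃ l a b : ℝ, 0 < l ∧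
    HasMatrices e K S
      !![2 * l, 0, 0; 0, -l, 0; 0, 0, -l]
      !![0, -l, 0; -l, 0, 0; 0, 0, 0]
      !![0, 0, -l; 0, 0, 0; -l, 0, 0]
      !![a, 0, 0; 0, b, 0; 0, 0, b]

/-- Canonical form with symmetry group `A₄`. -/
def FormIV (e : OrthonormalBasis (Fin 3) ℝ V) (K : V →ₗ[ℝ] V →ₗ[ℝ] V) (S : V →ₗ[ℝ] V) : Prop :=
  ∃ l a : ℝ, 0 < l ∧
    HasMatrices e K S
      !![0, 0, 0; 0, 0, l; 0, l, 0]
      !![0, 0, l; 0, 0, 0; l, 0, 0]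
      !![0, l, 0; l, 0, 0; 0, 0, 0]
      !![a, 0, 0; 0, a, 0; 0, 0, a]

/-- Canonical form with symmetry group `S₃`. -/
def FormV (e : OrthonormalBasis (Fin 3) ℝ V) (K : V →ₗ[ℝ] V →ₗ[ℝ] V) (S : V →ₗ[ℝ] V) : Prop :=
  ∃ l a b : ℝ, 0 < l ∧
    HasMatrices e K S
      !![l, 0, 0; 0, -l, 0; 0, 0, 0]
      !![0, -l, 0; -l, 0, 0; 0, 0, 0]
      0
      !![a, 0, 0; 0, a, 0; 0, 0, b]

/-- Canonical form with symmetry group `Z₂ × Z₂`. -/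
def FormVI (e : OrthonormalBasis (Fin 3) ℝ V) (K : V →ₗ[ℝ] V →ₗ[ℝ] V) (S : V →ₗ[ℝ] V) : Prop :=
  ∃ l a b c : ℝ,
    ((0 < l ∧ ¬(a = b ∧ b = c)) ∨ (l = 0 ∧ a ≠ b ∧ b ≠ c ∧ a ≠ c)) ∧
    HasMatrices e K S
      !![0, 0, 0; 0, 0, l; 0, l, 0]
      !![0, 0, l; 0, 0, 0; l, 0, 0]
      !![0, l, 0; l, 0, 0; 0, 0, 0]
      !![a, 0, 0; 0, b, 0; 0, 0, c]

/-- Canonical form with symmetry group `Z₃`. -/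
def FormVII (e : OrthonormalBasis (Fin 3) ℝ V) (K : V →ₗ[ℝ] V →ₗ[ℝ] V) (S : V →ₗ[ℝ] V) : Prop :=
  ∃ l m a b : ℝ,
    ((0 < l ∧ 0 < m ∧ m ≠ √2 * l) ∨ (m = √2 * l ∧ 0 < √2 * l ∧ a ≠ b)) ∧
    HasMatrices e K S
      !![2 * l, 0, 0; 0, -l, 0; 0, 0, -l]
      !![0, -l, 0; -l, m, 0; 0, 0, -m]
      !![0, 0, -l; 0, 0, -m; -l, -m, 0]
      !![a, 0, 0; 0, b, 0; 0, 0, b]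

/-- Canonical form with symmetry group `Z₂`. -/
def FormVIII (e : OrthonormalBasis (Fin 3) ℝ V) (K : V →ₗ[ℝ] V →ₗ[ℝ] V) (S : V →ₗ[ℝ] V) : Prop :=
  ∃ l m a b c d : ℝ,
    ((0 < l ∧ 0 < m ∧ l ≠ m) ∨
      (l = m ∧ 0 < m ∧ (b - c) ^ 2 + (b + c - 2 * a - 2 * d) ^ 2 ≠ 0) ∨
      (l = 0 ∧ 0 < m ∧ d ≠ 0) ∨
      (m = 0 ∧ 0 < l ∧ (b - c) ^ 2 + d ^ 2 ≠ 0)) ∧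
    HasMatrices e K S
      !![2 * l, 0, 0; 0, -l, m; 0, m, -l]
      !![0, -l, m; -l, 0, 0; m, 0, 0]
      !![0, m, -l; m, 0, 0; -l, 0, 0]
      !![a, 0, 0; 0, b, d; 0, d, c]

end CubicShape

open scoped Real InnerProductSpace

namespace CubicShape

variable {V : Type*} [NormedAddCommGroup V] [InnerProductSpace ℝ V]

/-! ### Isometries in an orthonormal frame -/

/-! A nontrivial rotation `g` preserving the pair has an axis. Take `e 0` on it, oriented so that
`⟪K (e 0) (e 0), e 0⟫` is nonnegative, and let `θ` be the angle. Rotations about `e 0` split the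
seven coefficients of `K` into weights 0, 1, 2, 3 and the six of `S` into weights 0, 1, 2, weight
`k` turning by `k` times the angle. Invariance under `g` always kills weight 1. For a half-turn it
also kills weight 3, so `K` becomes `IsMixed` and `S` is `IsBlock`. For any other angle it kills
weight 2 in both, so `K` becomes `IsAxial` and `S` is scalar on the plane orthogonal to `e 0`. In
each case a further turn of the basis about `e 0` makes the surviving coefficient `m` nonnegative.

These two normal families contain all the forms. Their generic members give (viii) and (vii). The
others are degenerations: `K = 0`, where `S` is diagonalized; no term of positive weight in `K`; the
planar cubic `Re (x + iy)^3` (mixed with `l = m`, axial with `l = 0`); and the tetrahedral cubic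
`xyz` (mixed with `l = 0`, axial with `m = √2 l`). The reduction is
`hasCanonicalForm_of_nontrivial`.

Conversely, the generators are checked on a basis. To bound the stabilizer from above one finds a
line that every symmetry preserves: an eigenline of `S`, a simple eigenline of the trace form `tr
(K_x K_y)`, or the kernel of `x ↦ K_x`. The sign of the cubic form orients the line where needed,
and the angle is then limited by weight 2 (`sin θ = 0`) or weight 3 (`cos 3θ = 1`). The tetrahedral
cubic has no distinguished line; its maxima on a sphere are the four vertices of a tetrahedron, so
its symmetries are even permutations of these (`IsMixed.exists_word`). -/

theorem isometry_ext (e : OrthonormalBasis (Fin 3) ℝ V) {g h : V ≃ₗᵢ[ℝ] V}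
    (h0 : g (e 0) = h (e 0)) (h1 : g (e 1) = h (e 1)) (h2 : g (e 2) = h (e 2)) : g = h := by
  apply LinearIsometryEquiv.toLinearEquiv_injective
  refine e.toBasis.ext' fun i => ?_
  fin_cases i <;> simpa

theorem linearMap_ext {W : Type*} [AddCommGroup W] [Module ℝ W]
    (e : OrthonormalBasis (Fin 3) ℝ V) {g h : V →ₗ[ℝ] W}
    (h0 : g (e 0) = h (e 0)) (h1 : g (e 1) = h (e 1)) (h2 : g (e 2) = h (e 2)) : g = h := by
  refine e.toBasis.ext fun i => ?_
  fin_cases i <;> simpa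

theorem expand (e : OrthonormalBasis (Fin 3) ℝ V) (x : V) :
    x = ⟪e 0, x⟫_ℝ • e 0 + ⟪e 1, x⟫_ℝ • e 1 + ⟪e 2, x⟫_ℝ • e 2 := by
  conv_lhs => rw [← e.sum_repr' x, Fin.sum_univ_three]

theorem vector_ext (e : OrthonormalBasis (Fin 3) ℝ V) {x y : V}
    (h0 : ⟪e 0, x⟫_ℝ = ⟪e 0, y⟫_ℝ) (h1 : ⟪e 1, x⟫_ℝ = ⟪e 1, y⟫_ℝ)
    (h2 : ⟪e 2, x⟫_ℝ = ⟪e 2, y⟫_ℝ) : x = y := by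
  rw [expand e x, expand e y, h0, h1, h2]

theorem inner_basis (e : OrthonormalBasis (Fin 3) ℝ V) (i j : Fin 3) :
    ⟪e i, e j⟫_ℝ = if i = j then 1 else 0 :=
  orthonormal_iff_ite.1 e.orthonormal i j

theorem inner_expand (e : OrthonormalBasis (Fin 3) ℝ V) (x y : V) :
    ⟪x, y⟫_ℝ = ⟪e 0, x⟫_ℝ * ⟪e 0, y⟫_ℝ + ⟪e 1, x⟫_ℝ * ⟪e 1, y⟫_ℝ + ⟪e 2, x⟫_ℝ * ⟪e 2, y⟫_ℝ := by
  rw [← e.sum_inner_mul_inner x y, Fin.sum_univ_three]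
  simp only [real_inner_comm]

/-- An orthonormal triple in a three-dimensional space, as an orthonormal basis. -/
theorem exists_basis_of_orthonormal (e : OrthonormalBasis (Fin 3) ℝ V) {v : Fin 3 → V}
    (hv : Orthonormal ℝ v) : ∃ b : OrthonormalBasis (Fin 3) ℝ V, ∀ i, b i = v i :=
  ⟨OrthonormalBasis.mk hv (hv.linearIndependent.span_eq_top_of_card_eq_finrank
      (Module.finrank_eq_card_basis e.toBasis).symm).ge, fun i => by simp⟩

theorem exists_isometry_of_orthonormal (e : OrthonormalBasis (Fin 3) ℝ V) {v : Fin 3 → V}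
    (hv : Orthonormal ℝ v) : ∃ g : V ≃ₗᵢ[ℝ] V, ∀ i, g (e i) = v i := by
  obtain ⟨b, hb⟩ := exists_basis_of_orthonormal e hv
  exact ⟨e.equiv b (Equiv.refl _), fun i => by simp [hb]⟩

/-- The matrix of an isometry in the frame `e`. -/
noncomputable def frameMatrix (e : OrthonormalBasis (Fin 3) ℝ V) :
    (V ≃ₗᵢ[ℝ] V) →* Matrix (Fin 3) (Fin 3) ℝ where
  toFun g := LinearMap.toMatrix e.toBasis e.toBasis g.toLinearEquiv.toLinearMap
  map_one' := LinearMap.toMatrix_one e.toBasis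
  map_mul' g h := LinearMap.toMatrix_mul e.toBasis g.toLinearEquiv.toLinearMap
    h.toLinearEquiv.toLinearMap

theorem frameMatrix_apply (e : OrthonormalBasis (Fin 3) ℝ V) (g : V ≃ₗᵢ[ℝ] V) (i j : Fin 3) :
    frameMatrix e g i j = ⟪e i, g (e j)⟫_ℝ := by
  change LinearMap.toMatrix e.toBasis e.toBasis g.toLinearEquiv.toLinearMap i j = _
  simp [LinearMap.toMatrix_apply, OrthonormalBasis.repr_apply_apply]

theorem mem_rotationGroup_iff (e : OrthonormalBasis (Fin 3) ℝ V) (g : V ≃ₗᵢ[ℝ] V) :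
    g ∈ rotationGroup V ↔ (frameMatrix e g).det = 1 := by
  change LinearEquiv.det g.toLinearEquiv = 1 ↔ _
  rw [← Units.val_inj, LinearEquiv.coe_det]
  change _ ↔ (LinearMap.toMatrix e.toBasis e.toBasis g.toLinearEquiv.toLinearMap).det = 1
  rw [LinearMap.det_toMatrix]
  rfl

theorem frameMatrix_injective (e : OrthonormalBasis (Fin 3) ℝ V) :
    Function.Injective (frameMatrix e) := by
  intro g h hgh
  have key : ∀ j, g (e j) = h (e j) := fun j => by
    apply vector_ext e <;> simp only [← frameMatrix_apply, hgh]
  exact isometry_ext e (key 0) (key 1) (key 2)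

theorem frameMatrix_mem_orthogonalGroup (e : OrthonormalBasis (Fin 3) ℝ V) (g : V ≃ₗᵢ[ℝ] V) :
    frameMatrix e g ∈ Matrix.orthogonalGroup (Fin 3) ℝ := by
  rw [Matrix.mem_orthogonalGroup_iff']
  ext i j
  have h : ⟪g (e i), g (e j)⟫_ℝ = _ := inner_expand e _ _
  rw [LinearIsometryEquiv.inner_map_map, inner_basis] at h
  simp only [Matrix.mul_apply, Matrix.transpose_apply, Fin.sum_univ_three, frameMatrix_apply,
    Matrix.one_apply]
  exact h.symm

theorem exists_frameMatrix_eq (e : OrthonormalBasis (Fin 3) ℝ V) {M : Matrix (Fin 3) (Fin 3) ℝ}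
    (hM : M ∈ Matrix.orthogonalGroup (Fin 3) ℝ) : ∃ g, frameMatrix e g = M := by
  rw [Matrix.mem_orthogonalGroup_iff'] at hM
  have hv : Orthonormal ℝ fun j => M 0 j • e 0 + M 1 j • e 1 + M 2 j • e 2 := by
    rw [orthonormal_iff_ite]
    intro i j
    have h := congrFun (congrFun hM i) j
    simp only [Matrix.mul_apply, Matrix.transpose_apply, Fin.sum_univ_three,
      Matrix.one_apply] at h
    rw [← h]
    simp [inner_add_left, inner_add_right, inner_smul_left, inner_smul_right, inner_basis,
      -inner_self_eq_norm_sq_to_K]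
    ring
  obtain ⟨g, hg⟩ := exists_isometry_of_orthonormal e hv
  refine ⟨g, ?_⟩
  ext i j
  rw [frameMatrix_apply, hg]
  fin_cases i <;> simp [inner_add_right, inner_smul_right, inner_basis,
      -inner_self_eq_norm_sq_to_K]

/-- `SO(V)` is isomorphic to the matrix group `SO(3)`. -/
theorem rotationGroup_equiv (e : OrthonormalBasis (Fin 3) ℝ V) :
    Nonempty (rotationGroup V ≃* Matrix.specialOrthogonalGroup (Fin 3) ℝ) := by
  let f : rotationGroup V →* Matrix.specialOrthogonalGroup (Fin 3) ℝ :=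
    ((frameMatrix e).comp (rotationGroup V).subtype).codRestrict
      (Matrix.specialOrthogonalGroup (Fin 3) ℝ) fun g =>
        Matrix.mem_specialOrthogonalGroup_iff.2
          ⟨frameMatrix_mem_orthogonalGroup e g, (mem_rotationGroup_iff e g).1 g.2⟩
  refine ⟨MulEquiv.ofBijective f ⟨fun g h hgh => ?_, fun M => ?_⟩⟩
  · exact Subtype.ext (frameMatrix_injective e (congrArg Subtype.val hgh))
  · obtain ⟨hO, hdet⟩ := Matrix.mem_specialOrthogonalGroup_iff.1 M.2
    obtain ⟨g, hg⟩ := exists_frameMatrix_eq e hO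
    refine ⟨⟨g, (mem_rotationGroup_iff e g).2 (hg ▸ hdet)⟩, Subtype.ext hg⟩

/-! ### Rotations about the coordinate axes -/

theorem axisRotation_basis (e : OrthonormalBasis (Fin 3) ℝ V) (i j : Fin 3) (θ : ℝ) :
    axisRotation e i θ (e j) = rotatedFrame e i θ j := by
  simp [axisRotation, rotatedBasis]

theorem rotatedBasis_apply (e : OrthonormalBasis (Fin 3) ℝ V) (i j : Fin 3) (θ : ℝ) :
    rotatedBasis e i θ j = rotatedFrame e i θ j := by
  simp [rotatedBasis]

theorem rotatedFrame_self (e : OrthonormalBasis (Fin 3) ℝ V) (i : Fin 3) (θ : ℝ) :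
    rotatedFrame e i θ i = e i := by simp [rotatedFrame]

section
variable (e : OrthonormalBasis (Fin 3) ℝ V) (θ : ℝ)

theorem rotatedFrame_zero_one :
    rotatedFrame e 0 θ 1 = Real.cos θ • e 1 + Real.sin θ • e 2 := by simp [rotatedFrame]
theorem rotatedFrame_zero_two :
    rotatedFrame e 0 θ 2 = -(Real.sin θ • e 1) + Real.cos θ • e 2 := by simp [rotatedFrame]
theorem rotatedFrame_one_two :
    rotatedFrame e 1 θ 2 = Real.cos θ • e 2 + Real.sin θ • e 0 := by simp [rotatedFrame]
theorem rotatedFrame_one_zero :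
    rotatedFrame e 1 θ 0 = -(Real.sin θ • e 2) + Real.cos θ • e 0 := by simp [rotatedFrame]
theorem rotatedFrame_two_zero :
    rotatedFrame e 2 θ 0 = Real.cos θ • e 0 + Real.sin θ • e 1 := by simp [rotatedFrame]
theorem rotatedFrame_two_one :
    rotatedFrame e 2 θ 1 = -(Real.sin θ • e 0) + Real.cos θ • e 1 := by simp [rotatedFrame]

end

attribute [simp] axisRotation_basis rotatedBasis_apply rotatedFrame_self rotatedFrame_zero_one
  rotatedFrame_zero_two rotatedFrame_one_two rotatedFrame_one_zero rotatedFrame_two_zero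
  rotatedFrame_two_one

theorem axisRotation_mem_rotationGroup (e : OrthonormalBasis (Fin 3) ℝ V) (i : Fin 3) (θ : ℝ) :
    axisRotation e i θ ∈ rotationGroup V := by
  have hc := Real.cos_sq_add_sin_sq θ
  rw [mem_rotationGroup_iff e, Matrix.det_fin_three]
  simp only [frameMatrix_apply]
  fin_cases i <;> simp [inner_add_right, inner_smul_right, inner_basis,
      -inner_self_eq_norm_sq_to_K] <;> linarith

theorem axisRotation_add (e : OrthonormalBasis (Fin 3) ℝ V) (i : Fin 3) (θ φ : ℝ) :
    axisRotation e i (θ + φ) = axisRotation e i θ * axisRotation e i φ := by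
  apply isometry_ext e <;> fin_cases i <;>
    simp [Real.cos_add, Real.sin_add] <;> module

theorem axisRotation_zero (e : OrthonormalBasis (Fin 3) ℝ V) (i : Fin 3) :
    axisRotation e i 0 = 1 := by
  apply isometry_ext e <;> fin_cases i <;> simp

theorem axisRotation_natCast_mul (e : OrthonormalBasis (Fin 3) ℝ V) (i : Fin 3) (n : ℕ) (θ : ℝ) :
    axisRotation e i (n * θ) = axisRotation e i θ ^ n := by
  induction n with
  | zero => simp [axisRotation_zero]
  | succ n ih => rw [pow_succ, ← ih, ← axisRotation_add]; congr 1; push_cast; ring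

theorem axisRotation_intCast_mul (e : OrthonormalBasis (Fin 3) ℝ V) (i : Fin 3) (n : ℤ) (θ : ℝ) :
    axisRotation e i (n * θ) = axisRotation e i θ ^ n := by
  have key : ∀ φ, axisRotation e i (-φ) = (axisRotation e i φ)⁻¹ := fun φ => by
    rw [eq_inv_iff_mul_eq_one, ← axisRotation_add, neg_add_cancel, axisRotation_zero]
  obtain ⟨m, rfl | rfl⟩ := n.eq_nat_or_neg
  · simpa using axisRotation_natCast_mul e i m θ
  · rw [zpow_neg, zpow_natCast, ← axisRotation_natCast_mul, ← key]
    congr 1; push_cast; ring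

theorem halfTurn_mul_self (e : OrthonormalBasis (Fin 3) ℝ V) (i : Fin 3) :
    halfTurn e i * halfTurn e i = 1 := by
  apply isometry_ext e <;> fin_cases i <;> simp [halfTurn]

theorem halfTurn_zero_basis (e : OrthonormalBasis (Fin 3) ℝ V) :
    halfTurn e 0 (e 0) = e 0 ∧ halfTurn e 0 (e 1) = -e 1 ∧ halfTurn e 0 (e 2) = -e 2 := by
  simp [halfTurn]

theorem halfTurn_one_basis (e : OrthonormalBasis (Fin 3) ℝ V) :
    halfTurn e 1 (e 0) = -e 0 ∧ halfTurn e 1 (e 1) = e 1 ∧ halfTurn e 1 (e 2) = -e 2 := by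
  simp [halfTurn]

theorem diagonalTurn_basis (e : OrthonormalBasis (Fin 3) ℝ V) :
    diagonalTurn e (e 0) = e 1 ∧ diagonalTurn e (e 1) = e 2 ∧ diagonalTurn e (e 2) = e 0 := by
  simp only [diagonalTurn, OrthonormalBasis.equiv_apply_basis]
  exact ⟨rfl, rfl, rfl⟩

theorem diagonalTurn_mem_rotationGroup (e : OrthonormalBasis (Fin 3) ℝ V) :
    diagonalTurn e ∈ rotationGroup V := by
  obtain ⟨h0, h1, h2⟩ := diagonalTurn_basis e
  rw [mem_rotationGroup_iff e, Matrix.det_fin_three]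
  simp [frameMatrix_apply, h0, h1, h2, inner_basis, -inner_self_eq_norm_sq_to_K]

theorem exists_cos_sin_eq {a b : ℝ} (h : a ^ 2 + b ^ 2 = 1) :
    ∃ θ, Real.cos θ = a ∧ Real.sin θ = b := by
  have hn : ‖(⟨a, b⟩ : ℂ)‖ = 1 := by
    rw [Complex.norm_def, Complex.normSq_mk, Real.sqrt_eq_one]; linarith
  refine ⟨Complex.arg ⟨a, b⟩, ?_, ?_⟩
  · have := Complex.norm_mul_cos_arg ⟨a, b⟩
    rwa [hn, one_mul] at this
  · have := Complex.norm_mul_sin_arg ⟨a, b⟩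
    rwa [hn, one_mul] at this

/-- Cramer's rule: the two linear equations in `(c, d)` have determinant `a ^ 2 + b ^ 2 = 1`, so the
first column of a plane rotation determines the second. -/
theorem rotation_block_aux {a b c d : ℝ} (h1 : a ^ 2 + b ^ 2 = 1)
    (h3 : a * c + b * d = 0) (h4 : a * d - b * c = 1) : c = -b ∧ d = a := by
  constructor
  · linear_combination a * h3 - b * h4 - c * h1
  · linear_combination b * h3 + a * h4 - d * h1

/-- A rotation fixing `e i` is a rotation about `e i`. -/
theorem exists_eq_axisRotation (e : OrthonormalBasis (Fin 3) ℝ V) (i : Fin 3) {g : V ≃ₗᵢ[ℝ] V}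
    (hg : g ∈ rotationGroup V) (hi : g (e i) = e i) : ∃ θ, g = axisRotation e i θ := by
  -- Since `e i = g (e i)`, the row of `e i` in the matrix of `g` is trivial, and only a 2 × 2 block
  -- remains.
  have hM : ∀ j, ⟪e i, g (e j)⟫_ℝ = if i = j then 1 else 0 := fun j => by
    nth_rewrite 1 [← hi]
    rw [LinearIsometryEquiv.inner_map_map, inner_basis]
  have hO : ∀ j k, ⟪g (e j), g (e k)⟫_ℝ = if j = k then 1 else 0 := fun j k => by
    rw [LinearIsometryEquiv.inner_map_map, inner_basis]
  rw [mem_rotationGroup_iff e, Matrix.det_fin_three] at hg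
  simp only [frameMatrix_apply] at hg
  have h1 := hO (i + 1) (i + 1)
  have h3 := hO (i + 1) (i + 2)
  rw [inner_expand e] at h1 h3
  have hj1 := hM (i + 1)
  have hj2 := hM (i + 2)
  have key : ∃ θ, Real.cos θ = ⟪e (i + 1), g (e (i + 1))⟫_ℝ ∧
      Real.sin θ = ⟪e (i + 2), g (e (i + 1))⟫_ℝ ∧
      ⟪e (i + 1), g (e (i + 2))⟫_ℝ = -Real.sin θ ∧
      ⟪e (i + 2), g (e (i + 2))⟫_ℝ = Real.cos θ := by
    have h1' : ⟪e (i + 1), g (e (i + 1))⟫_ℝ ^ 2 + ⟪e (i + 2), g (e (i + 1))⟫_ℝ ^ 2 = 1 := by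
      fin_cases i <;> simp at h1 hj1 hj2 ⊢ <;> simp only [hj1] at h1 <;> linarith
    obtain ⟨θ, hc, hs⟩ := exists_cos_sin_eq h1'
    refine ⟨θ, hc, hs, ?_⟩
    rw [hc, hs]
    apply rotation_block_aux h1'
    · fin_cases i <;> simp at h3 hj1 hj2 ⊢ <;> simp only [hj1, hj2] at h3 <;> linarith
    · fin_cases i <;> simp at hg hi hj1 hj2 ⊢ <;>
        simp [hi, hj1, hj2, inner_basis, -inner_self_eq_norm_sq_to_K] at hg <;> linarith
  obtain ⟨θ, hc, hs, hs', hc'⟩ := key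
  refine ⟨θ, isometry_ext e ?_ ?_ ?_⟩ <;> rw [axisRotation_basis] <;> fin_cases i <;>
    simp at hi hj1 hj2 hc hs hs' hc' ⊢ <;> first | exact hi | skip
  all_goals
    refine (expand e _).trans ?_
    simp only [hj1, hj2, hs', hc', ← hc, ← hs]
    module

/-! ### Finite groups given by generators -/

theorem pow_zmod_val_add {Γ : Type*} [Monoid Γ] {n : ℕ} [NeZero n] {p : Γ} (hp : p ^ n = 1)
    (a b : ZMod n) : p ^ (a + b).val = p ^ a.val * p ^ b.val := by
  rw [ZMod.val_add, ← pow_eq_pow_mod _ hp, pow_add]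

/-- Two commuting involutions generate a Klein four-group. -/
theorem closure_equiv_klein {Γ : Type*} [Group Γ] {p q : Γ} (hp : p ^ 2 = 1) (hq : q ^ 2 = 1)
    (hpq : Commute p q) (hp1 : p ≠ 1) (hq1 : q ≠ 1) (hne : p ≠ q) :
    Nonempty (Subgroup.closure {p, q} ≃* Multiplicative (ZMod 2) × Multiplicative (ZMod 2)) := by
  let f : Multiplicative (ZMod 2) × Multiplicative (ZMod 2) →* Γ :=
    { toFun := fun x => p ^ x.1.toAdd.val * q ^ x.2.toAdd.val
      map_one' := by simp
      map_mul' := fun x y => by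
        simp only [Prod.fst_mul, Prod.snd_mul, toAdd_mul, pow_zmod_val_add hp, pow_zmod_val_add hq]
        exact (hpq.symm.pow_pow _ _).mul_mul_mul_comm _ _ |>.symm }
  have hpq1 : p * q ≠ 1 := fun h => hne (by
    rw [mul_eq_one_iff_eq_inv.1 h, inv_eq_iff_mul_eq_one, ← sq, hq])
  have hinj : Function.Injective f := by
    rw [injective_iff_map_eq_one]
    rintro ⟨a, b⟩ h
    change p ^ (a.toAdd : ZMod 2).val * q ^ (b.toAdd : ZMod 2).val = 1 at h
    have h2 : ∀ x : Multiplicative (ZMod 2), x = 1 ∨ x = Multiplicative.ofAdd 1 := by decide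
    have hv : (1 : ZMod 2).val = 1 := rfl
    rcases h2 a with rfl | rfl <;> rcases h2 b with rfl | rfl <;> simp_all
  have hrange : f.range = Subgroup.closure {p, q} := by
    apply le_antisymm
    · rintro _ ⟨x, rfl⟩
      exact mul_mem (pow_mem (Subgroup.subset_closure (by simp)) _)
        (pow_mem (Subgroup.subset_closure (by simp)) _)
    · rw [Subgroup.closure_le]
      rintro x (rfl | rfl)
      · exact ⟨(Multiplicative.ofAdd 1, 1), by
          change x ^ (1 : ZMod 2).val * q ^ (0 : ZMod 2).val = x
          rw [show (1 : ZMod 2).val = 1 from rfl]; simp⟩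
      · exact ⟨(1, Multiplicative.ofAdd 1), by
          change p ^ (0 : ZMod 2).val * x ^ (1 : ZMod 2).val = x
          rw [show (1 : ZMod 2).val = 1 from rfl]; simp⟩
  exact ⟨(MulEquiv.subgroupCongr hrange).symm.trans (MonoidHom.ofInjective hinj).symm⟩

/-- The relations give every product the normal form `r ^ i` or `s * r ^ i`. No element of the
second kind is trivial: otherwise `s` would be a power of `r`, hence commute with it, and `r = r⁻¹`
together with `r ^ 3 = 1` would force `r = 1`. -/
theorem closure_equiv_dihedral {Γ : Type*} [Group Γ] {s r : Γ} (hs : s * s = 1) (hr : r ^ 3 = 1)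
    (hsr : s * r * s = r⁻¹) (hr1 : r ≠ 1) :
    Nonempty (Subgroup.closure {s, r} ≃* DihedralGroup 3) := by
  have hsinv : s⁻¹ = s := inv_eq_of_mul_eq_one_left hs
  have hconj : ∀ n : ℕ, r ^ n * s = s * (r ^ n)⁻¹ := fun n => by
    have h : s * r ^ n * s⁻¹ = (r ^ n)⁻¹ := by
      rw [← conj_pow, hsinv, hsr, inv_pow]
    rw [← h, hsinv, ← mul_assoc, ← mul_assoc, hs, one_mul]
  -- Multiplication in `DihedralGroup` produces the indices `j - i`, so powers with a difference as
  -- exponent are needed.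
  have hsub : ∀ a b : ZMod 3, r ^ (b - a).val = (r ^ a.val)⁻¹ * r ^ b.val := fun a b => by
    rw [eq_inv_mul_iff_mul_eq, ← pow_zmod_val_add hr, add_sub_cancel]
  let F : DihedralGroup 3 → Γ
    | .r i => r ^ i.val
    | .sr i => s * r ^ i.val
  let f : DihedralGroup 3 →* Γ := MonoidHom.mk' F <| by
    rintro (i | i) (j | j)
    · exact pow_zmod_val_add hr i j
    · change s * r ^ (j - i).val = r ^ i.val * (s * r ^ j.val)
      rw [hsub, ← mul_assoc, ← hconj, mul_assoc]
    · change s * r ^ (i + j).val = s * r ^ i.val * r ^ j.val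
      rw [pow_zmod_val_add hr, mul_assoc]
    · change r ^ (j - i).val = s * r ^ i.val * (s * r ^ j.val)
      rw [hsub, mul_assoc, ← mul_assoc _ s, hconj, mul_assoc, ← mul_assoc s s, hs, one_mul]
  have hr2 : r ^ 2 ≠ 1 := fun h => hr1 (by rwa [pow_succ, h, one_mul] at hr)
  have hinj : Function.Injective f := by
    rw [injective_iff_map_eq_one]
    rintro (i | i) h
    · change r ^ i.val = 1 at h
      have hi := i.val_lt
      have hi0 : i.val = 0 := by
        by_contra h0
        rcases (by omega : i.val = 1 ∨ i.val = 2) with h1 | h1 <;> rw [h1] at h <;> simp_all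
      rw [(ZMod.val_eq_zero i).1 hi0]; rfl
    · exfalso
      change s * r ^ i.val = 1 at h
      have hc : Commute s r := by
        rw [mul_eq_one_iff_eq_inv.1 h]
        exact ((Commute.refl r).pow_left _).inv_left
      rw [hc.eq, mul_assoc, hs, mul_one, eq_inv_iff_mul_eq_one, ← sq] at hsr
      exact hr2 hsr
  have hrange : f.range = Subgroup.closure {s, r} := by
    have h1 : (1 : ZMod 3).val = 1 := rfl
    apply le_antisymm
    · rintro _ ⟨i | i, rfl⟩
      · exact pow_mem (Subgroup.subset_closure (by simp)) _
      · exact mul_mem (Subgroup.subset_closure (by simp))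
          (pow_mem (Subgroup.subset_closure (by simp)) _)
    · rw [Subgroup.closure_le]
      rintro x (rfl | rfl)
      · exact ⟨.sr 0, by change x * r ^ (0 : ZMod 3).val = x; simp⟩
      · exact ⟨.r 1, by change x ^ (1 : ZMod 3).val = x; rw [h1, pow_one]⟩
  exact ⟨(MulEquiv.subgroupCongr hrange).symm.trans (MonoidHom.ofInjective hinj).symm⟩

/-- An involution and an element of order three which it inverts generate a copy of `S₃`. -/
theorem closure_equiv_perm_three {Γ : Type*} [Group Γ] {s r : Γ} (hs : s * s = 1)
    (hr : r ^ 3 = 1) (hsr : s * r * s = r⁻¹) (hr1 : r ≠ 1) :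
    Nonempty (Subgroup.closure {s, r} ≃* Equiv.Perm (Fin 3)) := by
  obtain ⟨φ⟩ := closure_equiv_dihedral hs hr hsr hr1
  -- A transposition and a 3-cycle in `S₃` satisfy the same relations, so both groups are compared
  -- through `DihedralGroup 3`.
  obtain ⟨ψ⟩ := closure_equiv_dihedral (Γ := Equiv.Perm (Fin 3)) (s := Equiv.swap 0 1)
    (r := finRotate 3) (by decide) (by decide) (by decide) (by decide)
  have htop : Subgroup.closure {Equiv.swap 0 1, finRotate 3} =
      (⊤ : Subgroup (Equiv.Perm (Fin 3))) := by
    have key : ∀ σ : Equiv.Perm (Fin 3), ∃ (a : Fin 2) (c : Fin 3),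
        σ = Equiv.swap 0 1 ^ (a : ℕ) * finRotate 3 ^ (c : ℕ) := by decide
    rw [eq_top_iff]
    rintro σ -
    obtain ⟨a, c, rfl⟩ := key σ
    exact mul_mem (pow_mem (Subgroup.subset_closure (by simp)) _)
      (pow_mem (Subgroup.subset_closure (by simp)) _)
  exact ⟨φ.trans (ψ.symm.trans ((MulEquiv.subgroupCongr htop).trans Subgroup.topEquiv))⟩

/-- An element of prime order `p` generates a cyclic group of order `p`. -/
theorem closure_equiv_zmod {Γ : Type*} [Group Γ] {p : ℕ} [Fact p.Prime] {r : Γ} (hr : r ^ p = 1)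
    (hr1 : r ≠ 1) : Nonempty (Subgroup.closure {r} ≃* Multiplicative (ZMod p)) := by
  rw [← Subgroup.zpowers_eq_closure]
  have hcard : Nat.card (Subgroup.zpowers r) = p := by
    rw [Nat.card_zpowers, orderOf_eq_prime hr hr1]
  have := zmodCyclicMulEquiv (G := Subgroup.zpowers r) inferInstance
  rw [hcard] at this
  exact ⟨this.symm⟩

/-! ### Groups preserving an axis -/

/-- The rotations preserving the line spanned by `e 0`. -/
noncomputable def axisGroup (e : OrthonormalBasis (Fin 3) ℝ V) : Subgroup (V ≃ₗᵢ[ℝ] V) where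
  carrier := {g | g ∈ rotationGroup V ∧ (g (e 0) = e 0 ∨ g (e 0) = -e 0)}
  one_mem' := ⟨one_mem _, Or.inl rfl⟩
  mul_mem' := by
    rintro a b ⟨ha, ha'⟩ ⟨hb, hb'⟩
    refine ⟨mul_mem ha hb, ?_⟩
    rw [LinearIsometryEquiv.coe_mul, Function.comp_apply]
    rcases hb' with hb' | hb' <;> rcases ha' with ha' | ha' <;> simp [hb', ha']
  inv_mem' := by
    rintro a ⟨ha, ha'⟩
    refine ⟨inv_mem ha, ?_⟩
    rw [LinearIsometryEquiv.coe_inv, LinearIsometryEquiv.symm_apply_eq,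
      LinearIsometryEquiv.symm_apply_eq, map_neg]
    rcases ha' with ha' | ha' <;> simp [ha']

/-- An isometry preserving a line preserves its orthogonal plane, so the matrix in the frame is
block diagonal. -/
theorem inner_zero_of_mem_axisGroup (e : OrthonormalBasis (Fin 3) ℝ V) {g : V ≃ₗᵢ[ℝ] V}
    (hg : g ∈ axisGroup e) : ⟪e 1, g (e 0)⟫_ℝ = 0 ∧ ⟪e 2, g (e 0)⟫_ℝ = 0 ∧
      ⟪e 0, g (e 1)⟫_ℝ = 0 ∧ ⟪e 0, g (e 2)⟫_ℝ = 0 := by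
  have h1 := g.inner_map_map (e 0) (e 1)
  have h2 := g.inner_map_map (e 0) (e 2)
  rcases hg.2 with h | h <;> rw [h] at h1 h2 ⊢ <;> simp at h1 h2 ⊢ <;>
    exact ⟨h1, h2⟩

/-- The action on the plane orthogonal to `e 0`. -/
noncomputable def planeMatrix (e : OrthonormalBasis (Fin 3) ℝ V) :
    axisGroup e →* Matrix (Fin 2) (Fin 2) ℝ where
  toFun g := Matrix.of fun i j => ⟪e i.succ, g.1 (e j.succ)⟫_ℝ
  map_one' := by
    ext i j
    simp [inner_basis, Matrix.one_apply, -inner_self_eq_norm_sq_to_K]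
  map_mul' g h := by
    have hM := map_mul (frameMatrix e) g.1 h.1
    ext i j
    have := congrFun (congrFun hM i.succ) j.succ
    obtain ⟨-, -, h1, h2⟩ := inner_zero_of_mem_axisGroup e h.2
    have hj : ⟪e 0, h.1 (e j.succ)⟫_ℝ = 0 := by fin_cases j <;> assumption
    simp only [Matrix.mul_apply, frameMatrix_apply, Fin.sum_univ_three, hj] at this
    simp only [Matrix.of_apply, Matrix.mul_apply, Fin.sum_univ_two, Subgroup.coe_mul]
    simpa using this

theorem planeMatrix_apply (e : OrthonormalBasis (Fin 3) ℝ V) (g : axisGroup e) (i j : Fin 2) :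
    planeMatrix e g i j = ⟪e i.succ, g.1 (e j.succ)⟫_ℝ := rfl

theorem planeMatrix_mem (e : OrthonormalBasis (Fin 3) ℝ V) (g : axisGroup e) :
    planeMatrix e g ∈ Matrix.orthogonalGroup (Fin 2) ℝ := by
  rw [Matrix.mem_orthogonalGroup_iff']
  ext i j
  obtain ⟨-, -, h1, h2⟩ := inner_zero_of_mem_axisGroup e g.2
  have hj : ⟪e 0, g.1 (e j.succ)⟫_ℝ = 0 := by fin_cases j <;> assumption
  have h : ⟪g.1 (e i.succ), g.1 (e j.succ)⟫_ℝ = _ := inner_expand e _ _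
  rw [LinearIsometryEquiv.inner_map_map, inner_basis, hj] at h
  simp only [Matrix.mul_apply, Matrix.transpose_apply, Fin.sum_univ_two, planeMatrix_apply,
    Matrix.one_apply]
  simpa using h.symm

/-- The full determinant is one, so the determinant of the plane block is the sign with which `g`
acts on the axis. Hence the plane action loses no information, and rotations fixing `e 0` correspond
to `SO(2)` inside `O(2)`. -/
theorem det_planeMatrix (e : OrthonormalBasis (Fin 3) ℝ V) (g : axisGroup e) :
    ⟪e 0, g.1 (e 0)⟫_ℝ * (planeMatrix e g).det = 1 := by
  obtain ⟨h1, h2, h3, h4⟩ := inner_zero_of_mem_axisGroup e g.2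
  have h := (mem_rotationGroup_iff e g.1).1 g.2.1
  rw [Matrix.det_fin_three] at h
  simp only [frameMatrix_apply, h1, h2, h3, h4] at h
  rw [Matrix.det_fin_two]
  simp only [planeMatrix_apply]
  simp
  linarith

theorem planeMatrix_det_eq_one_iff (e : OrthonormalBasis (Fin 3) ℝ V) (g : axisGroup e) :
    (planeMatrix e g).det = 1 ↔ g.1 (e 0) = e 0 := by
  have h := det_planeMatrix e g
  have h1 : ⟪e 0, e 0⟫_ℝ = 1 := by simp [inner_basis, -inner_self_eq_norm_sq_to_K]
  constructor
  · intro hd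
    rw [hd, mul_one] at h
    rcases g.2.2 with h' | h'
    · exact h'
    · rw [h', inner_neg_right, h1] at h
      norm_num at h
  · intro h'
    rwa [h', h1, one_mul] at h

theorem planeMatrix_injective (e : OrthonormalBasis (Fin 3) ℝ V) :
    Function.Injective (planeMatrix e) := by
  rw [injective_iff_map_eq_one]
  intro g hg
  have h0 := (planeMatrix_det_eq_one_iff e g).1 (by rw [hg, Matrix.det_one])
  obtain ⟨h1, h2, h3, h4⟩ := inner_zero_of_mem_axisGroup e g.2
  have key : ∀ i j : Fin 2, ⟪e i.succ, g.1 (e j.succ)⟫_ℝ = ⟪e i.succ, e j.succ⟫_ℝ := fun i j => by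
    rw [← planeMatrix_apply, hg, inner_basis, Matrix.one_apply]; simp
  refine Subtype.ext (isometry_ext e h0 ?_ ?_)
  · exact vector_ext e (h3.trans (by simp)) (key 0 0) (key 1 0)
  · exact vector_ext e (h4.trans (by simp)) (key 0 1) (key 1 1)

theorem exists_planeMatrix_eq (e : OrthonormalBasis (Fin 3) ℝ V) {N : Matrix (Fin 2) (Fin 2) ℝ}
    (hN : N ∈ Matrix.orthogonalGroup (Fin 2) ℝ) : ∃ g, planeMatrix e g = N := by
  have hd : N.det * N.det = 1 := by
    have := congrArg Matrix.det ((Matrix.mem_orthogonalGroup_iff' (Fin 2) ℝ).1 hN)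
    simpa using this
  rw [Matrix.mem_orthogonalGroup_iff'] at hN
  have h : ∀ i j, N 0 i * N 0 j + N 1 i * N 1 j = if i = j then 1 else 0 := fun i j => by
    have := congrFun (congrFun hN i) j
    simpa [Matrix.mul_apply, Fin.sum_univ_two, Matrix.one_apply] using this
  -- The corner entry `N.det = ±1` is the one that makes the total determinant `N.det * N.det = 1`.
  have hM : !![N.det, 0, 0; 0, N 0 0, N 0 1; 0, N 1 0, N 1 1] ∈
      Matrix.orthogonalGroup (Fin 3) ℝ := by
    rw [Matrix.mem_orthogonalGroup_iff']
    ext i j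
    fin_cases i <;> fin_cases j <;>
      simp [Matrix.mul_apply, Fin.sum_univ_three, hd, h]
  obtain ⟨g, hg⟩ := exists_frameMatrix_eq e hM
  have hent : ∀ i j, ⟪e i, g (e j)⟫_ℝ =
      !![N.det, 0, 0; 0, N 0 0, N 0 1; 0, N 1 0, N 1 1] i j := fun i j => by
    rw [← frameMatrix_apply, hg]
  have hg0 : g (e 0) = N.det • e 0 := by
    rw [expand e (g (e 0)), hent, hent, hent]; simp
  have hgrot : g ∈ rotationGroup V := by
    rw [mem_rotationGroup_iff e, hg, Matrix.det_fin_three]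
    simp [Matrix.det_fin_two] at hd ⊢
    linarith
  refine ⟨⟨g, hgrot, ?_⟩, ?_⟩
  · rcases mul_self_eq_one_iff.1 hd with h1 | h1 <;> simp [hg0, h1]
  · ext i j
    rw [planeMatrix_apply, hent]
    fin_cases i <;> fin_cases j <;> rfl

theorem axisGroup_equiv (e : OrthonormalBasis (Fin 3) ℝ V) :
    Nonempty (axisGroup e ≃* Matrix.orthogonalGroup (Fin 2) ℝ) := by
  refine ⟨MulEquiv.ofBijective ((planeMatrix e).codRestrict
    (Matrix.orthogonalGroup (Fin 2) ℝ) (planeMatrix_mem e)) ⟨fun g h hgh => ?_, fun N => ?_⟩⟩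
  · exact planeMatrix_injective e (congrArg Subtype.val hgh)
  · obtain ⟨g, hg⟩ := exists_planeMatrix_eq e N.2
    exact ⟨g, Subtype.ext hg⟩

/-- The rotations about a fixed axis form a group isomorphic to `SO(2)`. -/
theorem equiv_specialOrthogonalGroup_two (e : OrthonormalBasis (Fin 3) ℝ V)
    {G : Subgroup (V ≃ₗᵢ[ℝ] V)}
    (hG : ∀ g, g ∈ G ↔ g ∈ rotationGroup V ∧ g (e 0) = e 0) :
    Nonempty (G ≃* Matrix.specialOrthogonalGroup (Fin 2) ℝ) := by
  have hle : G ≤ axisGroup e := fun g hg => ⟨((hG g).1 hg).1, Or.inl ((hG g).1 hg).2⟩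
  refine ⟨MulEquiv.ofBijective (((planeMatrix e).comp (Subgroup.inclusion hle)).codRestrict
    (Matrix.specialOrthogonalGroup (Fin 2) ℝ) fun g =>
      Matrix.mem_specialOrthogonalGroup_iff.2 ⟨planeMatrix_mem e _,
        (planeMatrix_det_eq_one_iff e _).2 ((hG g).1 g.2).2⟩) ⟨fun g h hgh => ?_, fun N => ?_⟩⟩
  · exact Subgroup.inclusion_injective hle (planeMatrix_injective e (congrArg Subtype.val hgh))
  · obtain ⟨hO, hdet⟩ := Matrix.mem_specialOrthogonalGroup_iff.1 N.2
    obtain ⟨g, hg⟩ := exists_planeMatrix_eq e hO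
    exact ⟨⟨g, (hG g).2 ⟨g.2.1, (planeMatrix_det_eq_one_iff e g).1 (hg ▸ hdet)⟩⟩, Subtype.ext hg⟩

/-- A rotation preserving the axis `e 0` is a rotation about it, possibly followed by `P₂`. -/
theorem mem_axisGroup_iff (e : OrthonormalBasis (Fin 3) ℝ V) (g : V ≃ₗᵢ[ℝ] V) :
    g ∈ axisGroup e ↔
      ∃ θ, g = axisRotation e 0 θ ∨ g = halfTurn e 1 * axisRotation e 0 θ := by
  have hP : halfTurn e 1 ∈ axisGroup e :=
    ⟨axisRotation_mem_rotationGroup e 1 π, Or.inr (halfTurn_one_basis e).1⟩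
  have hR : ∀ θ, axisRotation e 0 θ ∈ axisGroup e := fun θ =>
    ⟨axisRotation_mem_rotationGroup e 0 θ, Or.inl (by simp)⟩
  constructor
  · rintro ⟨hg, h | h⟩
    · obtain ⟨θ, rfl⟩ := exists_eq_axisRotation e 0 hg h
      exact ⟨θ, Or.inl rfl⟩
    -- The half-turn about `e 1` reverses the axis back, so its product with `g` fixes `e 0`.
    · obtain ⟨θ, hθ⟩ := exists_eq_axisRotation e 0 (mul_mem hP.1 hg) (by simp [h, halfTurn])
      exact ⟨θ, Or.inr (by rw [← hθ, ← mul_assoc, halfTurn_mul_self, one_mul])⟩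
  · rintro ⟨θ, rfl | rfl⟩
    · exact hR θ
    · exact mul_mem hP (hR θ)

theorem axisGroup_eq_closure (e : OrthonormalBasis (Fin 3) ℝ V) :
    axisGroup e = Subgroup.closure (Set.range (axisRotation e 0) ∪ {halfTurn e 1}) := by
  apply le_antisymm
  · intro g hg
    have hR : ∀ θ, axisRotation e 0 θ ∈
        Subgroup.closure (Set.range (axisRotation e 0) ∪ {halfTurn e 1}) := fun θ =>
      Subgroup.subset_closure (Or.inl ⟨θ, rfl⟩)
    obtain ⟨θ, rfl | rfl⟩ := (mem_axisGroup_iff e g).1 hg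
    · exact hR θ
    · exact mul_mem (Subgroup.subset_closure (Or.inr rfl)) (hR θ)
  · rw [Subgroup.closure_le]
    rintro _ (⟨θ, rfl⟩ | rfl)
    · exact (mem_axisGroup_iff e _).2 ⟨θ, Or.inl rfl⟩
    · exact (mem_axisGroup_iff e _).2 ⟨0, Or.inr (by rw [axisRotation_zero, mul_one])⟩

/-! ### The rotation group of the regular tetrahedron -/

/-- The vertices of a regular tetrahedron. -/
noncomputable def tetrahedron (e : OrthonormalBasis (Fin 3) ℝ V) : Fin 4 → V :=
  ![e 0 + e 1 + e 2, e 0 - e 1 - e 2, -e 0 + e 1 - e 2, -e 0 - e 1 + e 2]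

theorem inner_tetrahedron (e : OrthonormalBasis (Fin 3) ℝ V) (i j : Fin 4) :
    ⟪tetrahedron e i, tetrahedron e j⟫_ℝ = if i = j then 3 else -1 := by
  fin_cases i <;> fin_cases j <;>
    simp [tetrahedron, inner_add_left, inner_add_right, inner_sub_left, inner_sub_right,
      inner_basis, -inner_self_eq_norm_sq_to_K] <;> norm_num

theorem tetrahedron_injective (e : OrthonormalBasis (Fin 3) ℝ V) :
    Function.Injective (tetrahedron e) := by
  intro i j h
  by_contra hij
  have h1 := inner_tetrahedron e i i
  have h2 := inner_tetrahedron e i j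
  rw [← h] at h2
  simp only [if_true, if_neg hij] at h1 h2
  linarith

theorem sum_tetrahedron (e : OrthonormalBasis (Fin 3) ℝ V) (σ : Equiv.Perm (Fin 4)) :
    tetrahedron e (σ 0) + tetrahedron e (σ 1) + tetrahedron e (σ 2) + tetrahedron e (σ 3) = 0 := by
  have h := Equiv.sum_comp σ (tetrahedron e)
  rw [Fin.sum_univ_four] at h
  rw [h, Fin.sum_univ_four]
  simp only [tetrahedron, Matrix.cons_val]
  abel

/-- The coordinate axes pass through the midpoints of the edges at vertex 0, so the vertices span
the space. -/
theorem basis_eq_tetrahedron (e : OrthonormalBasis (Fin 3) ℝ V) (j : Fin 3) :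
    e j = (1 / 2 : ℝ) • (tetrahedron e 0 + tetrahedron e j.succ) := by
  fin_cases j <;> simp [tetrahedron] <;> module

/-- Isometries that agree on the vertices are equal. -/
theorem isometry_ext_tetrahedron (e : OrthonormalBasis (Fin 3) ℝ V) {g h : V ≃ₗᵢ[ℝ] V}
    (hgh : ∀ i, g (tetrahedron e i) = h (tetrahedron e i)) : g = h := by
  have key : ∀ j, g (e j) = h (e j) := fun j => by
    rw [basis_eq_tetrahedron e j]; simp only [map_smul, map_add, hgh]
  exact isometry_ext e (key 0) (key 1) (key 2)

/-- The Gram matrix of the vertices is invariant under permutations. Permuting them in the formula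
of `basis_eq_tetrahedron` therefore gives another orthonormal triple; the vanishing sum of the
vertices recovers the image of each. -/
theorem exists_tetrahedron_isometry (e : OrthonormalBasis (Fin 3) ℝ V) (σ : Equiv.Perm (Fin 4)) :
    ∃ g : V ≃ₗᵢ[ℝ] V, ∀ i, g (tetrahedron e i) = tetrahedron e (σ i) := by
  have hv : Orthonormal ℝ fun j : Fin 3 =>
      (1 / 2 : ℝ) • (tetrahedron e (σ 0) + tetrahedron e (σ j.succ)) := by
    rw [orthonormal_iff_ite]
    intro i j
    simp only [inner_smul_left, inner_smul_right, inner_add_left, inner_add_right,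
      inner_tetrahedron, EmbeddingLike.apply_eq_iff_eq, Fin.succ_inj, (Fin.succ_ne_zero _).symm,
      Fin.succ_ne_zero]
    by_cases h : i = j <;> simp [h] <;> norm_num
  obtain ⟨g, hg⟩ := exists_isometry_of_orthonormal e hv
  refine ⟨g, fun i => ?_⟩
  have hs := sum_tetrahedron e σ
  have h0 := hg 0
  have h1 := hg 1
  have h2 := hg 2
  simp only [Fin.succ_zero_eq_one, Fin.succ_one_eq_two, show Fin.succ (2 : Fin 3) = 3 from rfl]
    at h0 h1 h2
  have h3 : tetrahedron e (σ 3) = -(tetrahedron e (σ 0) + tetrahedron e (σ 1) +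
      tetrahedron e (σ 2)) := by rw [eq_neg_iff_add_eq_zero, ← hs]; abel
  rw [h3] at h2
  fin_cases i
  · change g (e 0 + e 1 + e 2) = tetrahedron e (σ 0)
    simp only [map_add, h0, h1, h2]; module
  · change g (e 0 - e 1 - e 2) = tetrahedron e (σ 1)
    simp only [map_sub, h0, h1, h2]; module
  · change g (-e 0 + e 1 - e 2) = tetrahedron e (σ 2)
    simp only [map_add, map_sub, map_neg, h0, h1, h2]; module
  · change g (-e 0 - e 1 + e 2) = tetrahedron e (σ 3)
    simp only [map_add, map_sub, map_neg, h0, h1, h2, h3]; module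

/-- The symmetric group acting by isometries on the tetrahedron. -/
noncomputable def tetrahedronHom (e : OrthonormalBasis (Fin 3) ℝ V) :
    Equiv.Perm (Fin 4) →* (V ≃ₗᵢ[ℝ] V) :=
  MonoidHom.mk' (fun σ => (exists_tetrahedron_isometry e σ).choose) fun σ τ => by
    have h := fun σ => (exists_tetrahedron_isometry e σ).choose_spec
    apply isometry_ext_tetrahedron e
    intro i
    rw [LinearIsometryEquiv.coe_mul, Function.comp_apply, h, h, h]
    rfl

theorem tetrahedronHom_apply (e : OrthonormalBasis (Fin 3) ℝ V) (σ : Equiv.Perm (Fin 4))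
    (i : Fin 4) : tetrahedronHom e σ (tetrahedron e i) = tetrahedron e (σ i) :=
  (exists_tetrahedron_isometry e σ).choose_spec i

theorem tetrahedronHom_injective (e : OrthonormalBasis (Fin 3) ℝ V) :
    Function.Injective (tetrahedronHom e) := by
  intro σ τ h
  ext1 i
  apply tetrahedron_injective e
  rw [← tetrahedronHom_apply, h, tetrahedronHom_apply]

theorem eq_tetrahedronHom (e : OrthonormalBasis (Fin 3) ℝ V) {g : V ≃ₗᵢ[ℝ] V}
    {σ : Equiv.Perm (Fin 4)} (h : ∀ i, g (tetrahedron e i) = tetrahedron e (σ i)) :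
    g = tetrahedronHom e σ :=
  isometry_ext_tetrahedron e fun i => by rw [h, tetrahedronHom_apply]

theorem halfTurn_zero_eq (e : OrthonormalBasis (Fin 3) ℝ V) :
    halfTurn e 0 = tetrahedronHom e (Equiv.swap 0 1 * Equiv.swap 2 3) := by
  obtain ⟨h0, h1, h2⟩ := halfTurn_zero_basis e
  apply eq_tetrahedronHom e
  intro i
  fin_cases i <;> simp [tetrahedron, h0, h1, h2, Equiv.swap_apply_def] <;> abel

theorem halfTurn_one_eq (e : OrthonormalBasis (Fin 3) ℝ V) :
    halfTurn e 1 = tetrahedronHom e (Equiv.swap 0 2 * Equiv.swap 1 3) := by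
  obtain ⟨h0, h1, h2⟩ := halfTurn_one_basis e
  apply eq_tetrahedronHom e
  intro i
  fin_cases i <;> simp [tetrahedron, h0, h1, h2, Equiv.swap_apply_def] <;> abel

theorem diagonalTurn_eq (e : OrthonormalBasis (Fin 3) ℝ V) :
    diagonalTurn e = tetrahedronHom e (Equiv.swap 1 2 * Equiv.swap 2 3) := by
  obtain ⟨h0, h1, h2⟩ := diagonalTurn_basis e
  apply eq_tetrahedronHom e
  intro i
  fin_cases i <;> simp [tetrahedron, h0, h1, h2, Equiv.swap_apply_def] <;> abel

set_option maxRecDepth 100000 in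
-- In `A₄` the double transpositions form a normal Klein four-group, with a 3-cycle generating a
-- complement. This gives the 2 · 2 · 3 = 12 words.
theorem exists_word_of_sign_eq_one (σ : Equiv.Perm (Fin 4)) (h : Equiv.Perm.sign σ = 1) :
    ∃ (a b : Fin 2) (c : Fin 3), σ = (Equiv.swap 0 1 * Equiv.swap 2 3) ^ (a : ℕ) *
      (Equiv.swap 0 2 * Equiv.swap 1 3) ^ (b : ℕ) *
      (Equiv.swap 1 2 * Equiv.swap 2 3) ^ (c : ℕ) := by
  decide +revert

theorem map_alternatingGroup (e : OrthonormalBasis (Fin 3) ℝ V) :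
    (alternatingGroup (Fin 4)).map (tetrahedronHom e) =
      Subgroup.closure {halfTurn e 0, halfTurn e 1, diagonalTurn e} := by
  have h : alternatingGroup (Fin 4) = Subgroup.closure {Equiv.swap 0 1 * Equiv.swap 2 3,
      Equiv.swap 0 2 * Equiv.swap 1 3, Equiv.swap 1 2 * Equiv.swap 2 3} := by
    apply le_antisymm
    · intro σ hσ
      obtain ⟨a, b, c, rfl⟩ := exists_word_of_sign_eq_one σ hσ
      refine mul_mem (mul_mem ?_ ?_) ?_ <;> refine pow_mem (Subgroup.subset_closure ?_) _ <;> simp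
    · rw [Subgroup.closure_le]
      rintro _ (rfl | rfl | rfl) <;> exact Equiv.Perm.mem_alternatingGroup.2 (by decide)
  rw [h, MonoidHom.map_closure, halfTurn_zero_eq, halfTurn_one_eq, diagonalTurn_eq]
  simp [Set.image_insert_eq]

/-- The rotations of the tetrahedron are the even permutations of its vertices. -/
theorem tetrahedronHom_mem_rotationGroup_iff (e : OrthonormalBasis (Fin 3) ℝ V)
    (σ : Equiv.Perm (Fin 4)) :
    tetrahedronHom e σ ∈ rotationGroup V ↔ σ ∈ alternatingGroup (Fin 4) := by
  have heven : ∀ τ ∈ alternatingGroup (Fin 4), tetrahedronHom e τ ∈ rotationGroup V := by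
    intro τ hτ
    have hle : (alternatingGroup (Fin 4)).map (tetrahedronHom e) ≤ rotationGroup V := by
      rw [map_alternatingGroup, Subgroup.closure_le]
      rintro _ (rfl | rfl | rfl)
      · exact axisRotation_mem_rotationGroup e 0 π
      · exact axisRotation_mem_rotationGroup e 1 π
      · exact diagonalTurn_mem_rotationGroup e
    exact hle ⟨τ, hτ, rfl⟩
  refine ⟨fun h => ?_, heven σ⟩
  rw [Equiv.Perm.mem_alternatingGroup]
  refine (Int.units_eq_one_or _).resolve_right fun hs => ?_
  -- For odd `σ` this product is even, so the isometry of the transposition `swap 2 3` would be a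
  -- rotation. But it exchanges `e 1` and `e 2` and fixes `e 0`, so its determinant is -1.
  have h1 : tetrahedronHom e (σ⁻¹ * Equiv.swap 2 3) ∈ rotationGroup V := by
    apply heven
    rw [Equiv.Perm.mem_alternatingGroup, map_mul, Equiv.Perm.sign_inv, hs,
      Equiv.Perm.sign_swap (by decide)]
    rfl
  have h2 := mul_mem h h1
  rw [← map_mul, mul_inv_cancel_left] at h2
  have hb : ∀ j : Fin 3, tetrahedronHom e (Equiv.swap 2 3) (e j) = e (Equiv.swap 1 2 j) := by
    intro j
    rw [basis_eq_tetrahedron e j, basis_eq_tetrahedron e (Equiv.swap 1 2 j), map_smul, map_add,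
      tetrahedronHom_apply, tetrahedronHom_apply]
    fin_cases j <;> rfl
  rw [mem_rotationGroup_iff e, Matrix.det_fin_three] at h2
  simp [frameMatrix_apply, hb, inner_basis, Equiv.swap_apply_def,
    -inner_self_eq_norm_sq_to_K] at h2
  norm_num at h2

theorem closure_equiv_alternatingGroup (e : OrthonormalBasis (Fin 3) ℝ V) :
    Nonempty (Subgroup.closure {halfTurn e 0, halfTurn e 1, diagonalTurn e} ≃*
      alternatingGroup (Fin 4)) :=
  ⟨(((alternatingGroup (Fin 4)).equivMapOfInjective _ (tetrahedronHom_injective e)).trans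
    (MulEquiv.subgroupCongr (map_alternatingGroup e))).symm⟩

/-- A rotation mapping vertices to vertices belongs to the tetrahedral group. -/
theorem exists_word_of_maps_tetrahedron (e : OrthonormalBasis (Fin 3) ℝ V) {g : V ≃ₗᵢ[ℝ] V}
    (hg : g ∈ rotationGroup V) (h : ∀ i, ∃ j, g (tetrahedron e i) = tetrahedron e j) :
    ∃ (a b : Fin 2) (c : Fin 3),
      g = halfTurn e 0 ^ (a : ℕ) * halfTurn e 1 ^ (b : ℕ) * diagonalTurn e ^ (c : ℕ) := by
  choose f hf using h
  have hinj : Function.Injective f := fun i j hij => by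
    apply tetrahedron_injective e
    apply g.injective
    rw [hf, hf, hij]
  let σ : Equiv.Perm (Fin 4) := Equiv.ofBijective f (Finite.injective_iff_bijective.1 hinj)
  have hσ : g = tetrahedronHom e σ := eq_tetrahedronHom e hf
  rw [hσ, tetrahedronHom_mem_rotationGroup_iff] at hg
  obtain ⟨a, b, c, habc⟩ := exists_word_of_sign_eq_one σ hg
  refine ⟨a, b, c, ?_⟩
  rw [hσ, habc, halfTurn_zero_eq, halfTurn_one_eq, diagonalTurn_eq]
  simp only [map_mul, map_pow]

/-! ### Coordinate descriptions of `K` and `S` -/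

theorem toMatrix_eq_iff (e : OrthonormalBasis (Fin 3) ℝ V) (A : V →ₗ[ℝ] V)
    (M : Matrix (Fin 3) (Fin 3) ℝ) :
    LinearMap.toMatrix e.toBasis e.toBasis A = M ↔
      ∀ j, A (e j) = M 0 j • e 0 + M 1 j • e 1 + M 2 j • e 2 := by
  have hent : ∀ i j, LinearMap.toMatrix e.toBasis e.toBasis A i j = ⟪e i, A (e j)⟫_ℝ := by
    intro i j
    simp [LinearMap.toMatrix_apply, OrthonormalBasis.repr_apply_apply]
  constructor
  · rintro rfl j
    simp only [hent]
    exact expand e _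
  · intro h
    ext i j
    rw [hent, h]
    fin_cases i <;> simp [inner_add_right, inner_smul_right, inner_basis,
      -inner_self_eq_norm_sq_to_K]

/-- `K` is invariant under rotations about `e 0` up to a term of order three: the cubic form is
`l x₀ (2 x₀² - 3 x₁² - 3 x₂²) + m (x₁³ - 3 x₁ x₂²)`. -/
structure IsAxial (e : OrthonormalBasis (Fin 3) ℝ V) (K : V →ₗ[ℝ] V →ₗ[ℝ] V) (l m : ℝ) :
    Prop where
  k00 : K (e 0) (e 0) = (2 * l) • e 0
  k01 : K (e 0) (e 1) = -l • e 1
  k02 : K (e 0) (e 2) = -l • e 2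
  k10 : K (e 1) (e 0) = -l • e 1
  k11 : K (e 1) (e 1) = -l • e 0 + m • e 1
  k12 : K (e 1) (e 2) = -m • e 2
  k20 : K (e 2) (e 0) = -l • e 2
  k21 : K (e 2) (e 1) = -m • e 2
  k22 : K (e 2) (e 2) = -l • e 0 + -m • e 1

/-- The cubic form is `l x₀ (2 x₀² - 3 x₁² - 3 x₂²) + 6 m x₀ x₁ x₂`. -/
structure IsMixed (e : OrthonormalBasis (Fin 3) ℝ V) (K : V →ₗ[ℝ] V →ₗ[ℝ] V) (l m : ℝ) :
    Prop where
  k00 : K (e 0) (e 0) = (2 * l) • e 0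
  k01 : K (e 0) (e 1) = -l • e 1 + m • e 2
  k02 : K (e 0) (e 2) = m • e 1 + -l • e 2
  k10 : K (e 1) (e 0) = -l • e 1 + m • e 2
  k11 : K (e 1) (e 1) = -l • e 0
  k12 : K (e 1) (e 2) = m • e 0
  k20 : K (e 2) (e 0) = m • e 1 + -l • e 2
  k21 : K (e 2) (e 1) = m • e 0
  k22 : K (e 2) (e 2) = -l • e 0

/-- The cubic form is `l (x₀³ - 3 x₀ x₁²)`. -/
structure IsPlanar (e : OrthonormalBasis (Fin 3) ℝ V) (K : V →ₗ[ℝ] V →ₗ[ℝ] V) (l : ℝ) :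
    Prop where
  k00 : K (e 0) (e 0) = l • e 0
  k01 : K (e 0) (e 1) = -l • e 1
  k02 : K (e 0) (e 2) = 0
  k10 : K (e 1) (e 0) = -l • e 1
  k11 : K (e 1) (e 1) = -l • e 0
  k12 : K (e 1) (e 2) = 0
  k20 : K (e 2) (e 0) = 0
  k21 : K (e 2) (e 1) = 0
  k22 : K (e 2) (e 2) = 0

/-- `S` leaves `e 0` and the orthogonal plane invariant. -/
structure IsBlock (e : OrthonormalBasis (Fin 3) ℝ V) (S : V →ₗ[ℝ] V) (a b c d : ℝ) : Prop where
  s0 : S (e 0) = a • e 0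
  s1 : S (e 1) = b • e 1 + d • e 2
  s2 : S (e 2) = d • e 1 + c • e 2

section
variable (e : OrthonormalBasis (Fin 3) ℝ V) (K : V →ₗ[ℝ] V →ₗ[ℝ] V) (S : V →ₗ[ℝ] V)

theorem isBlock_iff (a b c d : ℝ) :
    LinearMap.toMatrix e.toBasis e.toBasis S = !![a, 0, 0; 0, b, d; 0, d, c] ↔
      IsBlock e S a b c d := by
  rw [toMatrix_eq_iff, Fin.forall_fin_succ, Fin.forall_fin_two]
  simp
  exact ⟨fun ⟨h0, h1, h2⟩ => ⟨h0, h1, h2⟩, fun ⟨h0, h1, h2⟩ => ⟨h0, h1, h2⟩⟩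

theorem isBlock_diagonal_iff (a b c : ℝ) :
    LinearMap.toMatrix e.toBasis e.toBasis S = !![a, 0, 0; 0, b, 0; 0, 0, c] ↔
      IsBlock e S a b c 0 := isBlock_iff e S a b c 0

theorem hasMatrices_zero_iff (T : Matrix (Fin 3) (Fin 3) ℝ) :
    HasMatrices e K S 0 0 0 T ↔ K = 0 ∧ LinearMap.toMatrix e.toBasis e.toBasis S = T := by
  simp only [HasMatrices, EmbeddingLike.map_eq_zero_iff, ← and_assoc, and_congr_left_iff]
  refine fun _ => ⟨fun ⟨⟨h0, h1⟩, h2⟩ => ?_, ?_⟩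
  · exact linearMap_ext e (by simpa using h0) (by simpa using h1) (by simpa using h2)
  · rintro rfl; simp

theorem hasMatrices_axial_iff (l m : ℝ) (T : Matrix (Fin 3) (Fin 3) ℝ) :
    HasMatrices e K S
      !![2 * l, 0, 0; 0, -l, 0; 0, 0, -l]
      !![0, -l, 0; -l, m, 0; 0, 0, -m]
      !![0, 0, -l; 0, 0, -m; -l, -m, 0] T ↔
    IsAxial e K l m ∧ LinearMap.toMatrix e.toBasis e.toBasis S = T := by
  simp only [HasMatrices, ← and_assoc, and_congr_left_iff]
  intro _
  simp only [toMatrix_eq_iff, Fin.forall_fin_succ]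
  simp
  constructor
  · rintro ⟨⟨⟨h1, h2, h3⟩, h4, h5, h6⟩, h7, h8, h9⟩
    constructor <;> simpa
  · rintro ⟨h1, h2, h3, h4, h5, h6, h7, h8, h9⟩
    simp at *
    tauto

theorem hasMatrices_mixed_iff (l m : ℝ) (T : Matrix (Fin 3) (Fin 3) ℝ) :
    HasMatrices e K S
      !![2 * l, 0, 0; 0, -l, m; 0, m, -l]
      !![0, -l, m; -l, 0, 0; m, 0, 0]
      !![0, m, -l; m, 0, 0; -l, 0, 0] T ↔
    IsMixed e K l m ∧ LinearMap.toMatrix e.toBasis e.toBasis S = T := by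
  simp only [HasMatrices, ← and_assoc, and_congr_left_iff]
  intro _
  simp only [toMatrix_eq_iff, Fin.forall_fin_succ]
  simp
  constructor
  · rintro ⟨⟨⟨h1, h2, h3⟩, h4, h5, h6⟩, h7, h8, h9⟩
    constructor <;> simpa
  · rintro ⟨h1, h2, h3, h4, h5, h6, h7, h8, h9⟩
    simp at *
    tauto

theorem hasMatrices_planar_iff (l : ℝ) (T : Matrix (Fin 3) (Fin 3) ℝ) :
    HasMatrices e K S
      !![l, 0, 0; 0, -l, 0; 0, 0, 0]
      !![0, -l, 0; -l, 0, 0; 0, 0, 0]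
      0 T ↔
    IsPlanar e K l ∧ LinearMap.toMatrix e.toBasis e.toBasis S = T := by
  simp only [HasMatrices, ← and_assoc, and_congr_left_iff]
  intro _
  simp only [toMatrix_eq_iff, Fin.forall_fin_succ]
  simp
  constructor
  · rintro ⟨⟨⟨h1, h2, h3⟩, h4, h5, h6⟩, h7, h8, h9⟩
    constructor <;> simpa
  · rintro ⟨h1, h2, h3, h4, h5, h6, h7, h8, h9⟩
    simp at *
    tauto

theorem formI_iff : FormI e K S ↔ ∃ a, K = 0 ∧ IsBlock e S a a a 0 := by
  simp only [FormI, hasMatrices_zero_iff, isBlock_diagonal_iff]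

theorem formII_iff : FormII e K S ↔ ∃ a b, a ≠ b ∧ K = 0 ∧ IsBlock e S a b b 0 := by
  simp only [FormII, hasMatrices_zero_iff, isBlock_diagonal_iff]

theorem formIII_iff : FormIII e K S ↔
    ∃ l a b, 0 < l ∧ IsAxial e K l 0 ∧ IsBlock e S a b b 0 := by
  have h := fun l => hasMatrices_axial_iff e K S l 0
  simp only [neg_zero] at h
  simp only [FormIII, h, isBlock_diagonal_iff]

theorem formIV_iff : FormIV e K S ↔
    ∃ l a, 0 < l ∧ IsMixed e K 0 l ∧ IsBlock e S a a a 0 := by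
  have h := hasMatrices_mixed_iff e K S 0
  simp only [neg_zero, mul_zero] at h
  simp only [FormIV, h, isBlock_diagonal_iff]

theorem formV_iff : FormV e K S ↔
    ∃ l a b, 0 < l ∧ IsPlanar e K l ∧ IsBlock e S a a b 0 := by
  simp only [FormV, hasMatrices_planar_iff, isBlock_diagonal_iff]

theorem formVI_iff : FormVI e K S ↔ ∃ l a b c,
    ((0 < l ∧ ¬(a = b ∧ b = c)) ∨ (l = 0 ∧ a ≠ b ∧ b ≠ c ∧ a ≠ c)) ∧
      IsMixed e K 0 l ∧ IsBlock e S a b c 0 := by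
  have h := hasMatrices_mixed_iff e K S 0
  simp only [neg_zero, mul_zero] at h
  simp only [FormVI, h, isBlock_diagonal_iff]

theorem formVII_iff : FormVII e K S ↔ ∃ l m a b,
    ((0 < l ∧ 0 < m ∧ m ≠ √2 * l) ∨ (m = √2 * l ∧ 0 < √2 * l ∧ a ≠ b)) ∧
      IsAxial e K l m ∧ IsBlock e S a b b 0 := by
  simp only [FormVII, hasMatrices_axial_iff, isBlock_diagonal_iff]

theorem formVIII_iff : FormVIII e K S ↔ ∃ l m a b c d,
    ((0 < l ∧ 0 < m ∧ l ≠ m) ∨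
      (l = m ∧ 0 < m ∧ (b - c) ^ 2 + (b + c - 2 * a - 2 * d) ^ 2 ≠ 0) ∨
      (l = 0 ∧ 0 < m ∧ d ≠ 0) ∨
      (m = 0 ∧ 0 < l ∧ (b - c) ^ 2 + d ^ 2 ≠ 0)) ∧
      IsMixed e K l m ∧ IsBlock e S a b c d := by
  simp only [FormVIII, hasMatrices_mixed_iff, isBlock_iff]

end

/-! ### Generators of the stabilizers -/

theorem mem_pairStabilizer_of_basis (e : OrthonormalBasis (Fin 3) ℝ V)
    {K : V →ₗ[ℝ] V →ₗ[ℝ] V} {S : V →ₗ[ℝ] V} {g : V ≃ₗᵢ[ℝ] V} (hg : g ∈ rotationGroup V)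
    (hK : ∀ i j, K (g (e i)) (g (e j)) = g (K (e i) (e j)))
    (hS : ∀ i, S (g (e i)) = g (S (e i))) : g ∈ pairStabilizer K S := by
  refine ⟨hg, fun X Y => ?_, fun X => ?_⟩
  · rw [expand e X, expand e Y]
    simp only [map_add, map_smul, LinearMap.add_apply, LinearMap.smul_apply, hK]
  · rw [expand e X]
    simp only [map_add, map_smul, hS]

theorem cos_two_pi_div_three : Real.cos (2 * π / 3) = -(1 / 2) := by
  rw [show 2 * π / 3 = π - π / 3 by ring, Real.cos_pi_sub, Real.cos_pi_div_three]

theorem sin_two_pi_div_three : Real.sin (2 * π / 3) = √3 / 2 := by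
  rw [show 2 * π / 3 = π - π / 3 by ring, Real.sin_pi_sub, Real.sin_pi_div_three]

section
variable {e : OrthonormalBasis (Fin 3) ℝ V} {K : V →ₗ[ℝ] V →ₗ[ℝ] V} {S : V →ₗ[ℝ] V}

theorem halfTurn_zero_mem_of_mixed {l m a b c d : ℝ} (hK : IsMixed e K l m)
    (hS : IsBlock e S a b c d) : halfTurn e 0 ∈ pairStabilizer K S := by
  obtain ⟨h0, h1, h2⟩ := halfTurn_zero_basis e
  obtain ⟨k00, k01, k02, k10, k11, k12, k20, k21, k22⟩ := hK
  obtain ⟨s0, s1, s2⟩ := hS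
  refine mem_pairStabilizer_of_basis e (axisRotation_mem_rotationGroup e 0 π) (fun i j => ?_)
    fun i => ?_
  · fin_cases i <;> fin_cases j <;>
      simp [h0, h1, h2, k00, k01, k02, k10, k11, k12, k20, k21, k22] <;> abel
  · fin_cases i <;> simp [h0, h1, h2, s0, s1, s2] <;> abel

theorem halfTurn_one_mem_of_mixed {m a b c : ℝ} (hK : IsMixed e K 0 m)
    (hS : IsBlock e S a b c 0) : halfTurn e 1 ∈ pairStabilizer K S := by
  obtain ⟨h0, h1, h2⟩ := halfTurn_one_basis e
  obtain ⟨k00, k01, k02, k10, k11, k12, k20, k21, k22⟩ := hK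
  obtain ⟨s0, s1, s2⟩ := hS
  refine mem_pairStabilizer_of_basis e (axisRotation_mem_rotationGroup e 1 π) (fun i j => ?_)
    fun i => ?_
  · fin_cases i <;> fin_cases j <;>
      simp [h0, h1, h2, k00, k01, k02, k10, k11, k12, k20, k21, k22]
  · fin_cases i <;> simp [h0, h1, h2, s0, s1, s2]

theorem diagonalTurn_mem_of_mixed {m a : ℝ} (hK : IsMixed e K 0 m)
    (hS : IsBlock e S a a a 0) : diagonalTurn e ∈ pairStabilizer K S := by
  obtain ⟨h0, h1, h2⟩ := diagonalTurn_basis e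
  obtain ⟨k00, k01, k02, k10, k11, k12, k20, k21, k22⟩ := hK
  obtain ⟨s0, s1, s2⟩ := hS
  refine mem_pairStabilizer_of_basis e (diagonalTurn_mem_rotationGroup e) (fun i j => ?_)
    fun i => ?_
  · fin_cases i <;> fin_cases j <;>
      simp [h0, h1, h2, k00, k01, k02, k10, k11, k12, k20, k21, k22]
  · fin_cases i <;> simp [h0, h1, h2, s0, s1, s2]

/-- With `m = 0` the cubic depends only on `x₀` and `x₁² + x₂²`. -/
theorem axisRotation_mem_of_axial {l a b : ℝ} (hK : IsAxial e K l 0)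
    (hS : IsBlock e S a b b 0) (θ : ℝ) : axisRotation e 0 θ ∈ pairStabilizer K S := by
  obtain ⟨k00, k01, k02, k10, k11, k12, k20, k21, k22⟩ := hK
  obtain ⟨s0, s1, s2⟩ := hS
  have hc := Real.cos_sq_add_sin_sq θ
  refine mem_pairStabilizer_of_basis e (axisRotation_mem_rotationGroup e 0 θ) (fun i j => ?_)
    fun i => ?_
  · fin_cases i <;> fin_cases j <;>
      simp [k00, k01, k02, k10, k11, k12, k20, k21, k22] <;>
      apply vector_ext e <;>
      simp [inner_add_right, inner_smul_right, inner_basis, -inner_self_eq_norm_sq_to_K] <;>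
      grind
  · fin_cases i <;> simp [s0, s1, s2] <;> module

/-- The extra term `x₁³ - 3 x₁ x₂²` is the real part of `(x₁ + i x₂)³`, which a third of a turn
leaves unchanged. -/
theorem thirdTurn_zero_mem_of_axial {l m a b : ℝ} (hK : IsAxial e K l m)
    (hS : IsBlock e S a b b 0) : thirdTurn e 0 ∈ pairStabilizer K S := by
  obtain ⟨k00, k01, k02, k10, k11, k12, k20, k21, k22⟩ := hK
  obtain ⟨s0, s1, s2⟩ := hS
  have hc : √3 ^ 2 = (3 : ℝ) := Real.sq_sqrt (by norm_num)
  refine mem_pairStabilizer_of_basis e (axisRotation_mem_rotationGroup e 0 _) (fun i j => ?_)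
    fun i => ?_
  · fin_cases i <;> fin_cases j <;>
      simp [thirdTurn, k00, k01, k02, k10, k11, k12, k20, k21, k22, cos_two_pi_div_three,
        sin_two_pi_div_three] <;>
      apply vector_ext e <;>
      simp [inner_add_right, inner_smul_right, inner_basis, -inner_self_eq_norm_sq_to_K] <;>
      grind
  · fin_cases i <;> simp [thirdTurn, s0, s1, s2] <;> module

theorem thirdTurn_two_mem_of_planar {l a b : ℝ} (hK : IsPlanar e K l)
    (hS : IsBlock e S a a b 0) : thirdTurn e 2 ∈ pairStabilizer K S := by
  obtain ⟨k00, k01, k02, k10, k11, k12, k20, k21, k22⟩ := hK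
  obtain ⟨s0, s1, s2⟩ := hS
  have hc : √3 ^ 2 = (3 : ℝ) := Real.sq_sqrt (by norm_num)
  refine mem_pairStabilizer_of_basis e (axisRotation_mem_rotationGroup e 2 _) (fun i j => ?_)
    fun i => ?_
  · fin_cases i <;> fin_cases j <;>
      simp [thirdTurn, k00, k01, k02, k10, k11, k12, k20, k21, k22, cos_two_pi_div_three,
        sin_two_pi_div_three] <;>
      apply vector_ext e <;>
      simp [inner_add_right, inner_smul_right, inner_basis, -inner_self_eq_norm_sq_to_K] <;>
      grind
  · fin_cases i <;> simp [thirdTurn, s0, s1, s2] <;> module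

theorem halfTurn_zero_mem_of_planar {l a b c : ℝ} (hK : IsPlanar e K l)
    (hS : IsBlock e S a b c 0) : halfTurn e 0 ∈ pairStabilizer K S := by
  obtain ⟨h0, h1, h2⟩ := halfTurn_zero_basis e
  obtain ⟨k00, k01, k02, k10, k11, k12, k20, k21, k22⟩ := hK
  obtain ⟨s0, s1, s2⟩ := hS
  refine mem_pairStabilizer_of_basis e (axisRotation_mem_rotationGroup e 0 π) (fun i j => ?_)
    fun i => ?_
  · fin_cases i <;> fin_cases j <;>
      simp [h0, h1, h2, k00, k01, k02, k10, k11, k12, k20, k21, k22]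
  · fin_cases i <;> simp [h0, h1, h2, s0, s1, s2]

/-! ### Invariants -/

theorem cubic_invariant {g : V ≃ₗᵢ[ℝ] V} (hg : g ∈ pairStabilizer K S) (x : V) :
    ⟪K (g x) (g x), g x⟫_ℝ = ⟪K x x, x⟫_ℝ := by
  rw [hg.2.1, LinearIsometryEquiv.inner_map_map]

theorem IsAxial.cubic {l m : ℝ} (hK : IsAxial e K l m) (y : V) :
    ⟪K y y, y⟫_ℝ = l * ⟪e 0, y⟫_ℝ * (2 * ⟪e 0, y⟫_ℝ ^ 2 - 3 * ⟪e 1, y⟫_ℝ ^ 2 -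
      3 * ⟪e 2, y⟫_ℝ ^ 2) + m * (⟪e 1, y⟫_ℝ ^ 3 - 3 * ⟪e 1, y⟫_ℝ * ⟪e 2, y⟫_ℝ ^ 2) := by
  obtain ⟨k00, k01, k02, k10, k11, k12, k20, k21, k22⟩ := hK
  have h : K y y = K (⟪e 0, y⟫_ℝ • e 0 + ⟪e 1, y⟫_ℝ • e 1 + ⟪e 2, y⟫_ℝ • e 2)
    (⟪e 0, y⟫_ℝ • e 0 + ⟪e 1, y⟫_ℝ • e 1 + ⟪e 2, y⟫_ℝ • e 2) := by rw [← expand e y]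
  rw [h]
  simp only [map_add, map_smul, LinearMap.add_apply, LinearMap.smul_apply, k00, k01, k02, k10,
    k11, k12, k20, k21, k22, inner_add_left, inner_smul_left, RCLike.conj_to_real, smul_add]
  ring

theorem IsMixed.cubic {l m : ℝ} (hK : IsMixed e K l m) (y : V) :
    ⟪K y y, y⟫_ℝ = l * ⟪e 0, y⟫_ℝ * (2 * ⟪e 0, y⟫_ℝ ^ 2 - 3 * ⟪e 1, y⟫_ℝ ^ 2 -
      3 * ⟪e 2, y⟫_ℝ ^ 2) + 6 * m * (⟪e 0, y⟫_ℝ * ⟪e 1, y⟫_ℝ * ⟪e 2, y⟫_ℝ) := by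
  obtain ⟨k00, k01, k02, k10, k11, k12, k20, k21, k22⟩ := hK
  have h : K y y = K (⟪e 0, y⟫_ℝ • e 0 + ⟪e 1, y⟫_ℝ • e 1 + ⟪e 2, y⟫_ℝ • e 2)
    (⟪e 0, y⟫_ℝ • e 0 + ⟪e 1, y⟫_ℝ • e 1 + ⟪e 2, y⟫_ℝ • e 2) := by rw [← expand e y]
  rw [h]
  simp only [map_add, map_smul, LinearMap.add_apply, LinearMap.smul_apply, k00, k01, k02, k10,
    k11, k12, k20, k21, k22, inner_add_left, inner_smul_left, RCLike.conj_to_real, smul_add]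
  ring

theorem IsPlanar.cubic {l : ℝ} (hK : IsPlanar e K l) (y : V) :
    ⟪K y y, y⟫_ℝ = l * (⟪e 0, y⟫_ℝ ^ 3 - 3 * ⟪e 0, y⟫_ℝ * ⟪e 1, y⟫_ℝ ^ 2) := by
  obtain ⟨k00, k01, k02, k10, k11, k12, k20, k21, k22⟩ := hK
  have h : K y y = K (⟪e 0, y⟫_ℝ • e 0 + ⟪e 1, y⟫_ℝ • e 1 + ⟪e 2, y⟫_ℝ • e 2)
    (⟪e 0, y⟫_ℝ • e 0 + ⟪e 1, y⟫_ℝ • e 1 + ⟪e 2, y⟫_ℝ • e 2) := by rw [← expand e y]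
  rw [h]
  simp only [map_add, map_smul, LinearMap.add_apply, LinearMap.smul_apply, k00, k01, k02, k10,
    k11, k12, k20, k21, k22, inner_add_left, inner_smul_left, RCLike.conj_to_real, smul_add,
    smul_zero, inner_zero_left]
  ring

theorem sq_add_sq_add_sq_image (e : OrthonormalBasis (Fin 3) ℝ V) (g : V ≃ₗᵢ[ℝ] V) (i : Fin 3) :
    ⟪e 0, g (e i)⟫_ℝ ^ 2 + ⟪e 1, g (e i)⟫_ℝ ^ 2 + ⟪e 2, g (e i)⟫_ℝ ^ 2 = 1 := by
  have h := inner_expand e (g (e i)) (g (e i))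
  rw [LinearIsometryEquiv.inner_map_map, inner_basis, if_pos rfl] at h
  rw [h]; ring

theorem image_eq_of_inner_eq_zero {g : V ≃ₗᵢ[ℝ] V} {i : Fin 3} (h1 : ⟪e 1, g (e i)⟫_ℝ = 0)
    (h2 : ⟪e 2, g (e i)⟫_ℝ = 0) : g (e i) = e 0 ∨ g (e i) = -e 0 := by
  have h := sq_add_sq_add_sq_image e g i
  rw [h1, h2] at h
  have h' : ⟪e 0, g (e i)⟫_ℝ ^ 2 = 1 := by linarith
  rw [expand e (g (e i)), h1, h2]
  rcases mul_self_eq_one_iff.1 ((sq _).symm.trans h') with h0 | h0 <;> simp [h0]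

/-- The `m` part of `K_{e₀}` is a nonzero traceless symmetric operator on the plane; a rotation of
the plane commutes with it only when it is ±1. -/
theorem IsMixed.sin_eq_zero {l m : ℝ} (hK : IsMixed e K l m) (hm : m ≠ 0) {θ : ℝ}
    (hg : axisRotation e 0 θ ∈ pairStabilizer K S) : Real.sin θ = 0 := by
  have h := hg.2.1 (e 0) (e 1)
  have h' := congrArg (fun x => ⟪e 1, x⟫_ℝ) h
  simp [hK.k01, hK.k02, inner_add_right, inner_smul_right, inner_basis,
    -inner_self_eq_norm_sq_to_K] at h'
  grind

end

/-! ### Axes preserved by the symmetries: eigenlines of `S` and of the trace form -/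

section
variable {e : OrthonormalBasis (Fin 3) ℝ V} {K : V →ₗ[ℝ] V →ₗ[ℝ] V} {S : V →ₗ[ℝ] V}

theorem IsBlock.inner_one {a b c d : ℝ} (hS : IsBlock e S a b c d) (y : V) :
    ⟪e 1, S y⟫_ℝ = b * ⟪e 1, y⟫_ℝ + d * ⟪e 2, y⟫_ℝ := by
  conv_lhs => rw [expand e y]
  simp [hS.s0, hS.s1, hS.s2, inner_add_right, inner_smul_right, inner_basis,
    -inner_self_eq_norm_sq_to_K]
  ring

theorem IsBlock.inner_two {a b c d : ℝ} (hS : IsBlock e S a b c d) (y : V) :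
    ⟪e 2, S y⟫_ℝ = d * ⟪e 1, y⟫_ℝ + c * ⟪e 2, y⟫_ℝ := by
  conv_lhs => rw [expand e y]
  simp [hS.s0, hS.s1, hS.s2, inner_add_right, inner_smul_right, inner_basis,
    -inner_self_eq_norm_sq_to_K]
  ring

/-- The image of an eigenvector of `S` is an eigenvector. -/
theorem IsBlock.image_eigenvector {a b c d : ℝ} (hS : IsBlock e S a b c d) {g : V ≃ₗᵢ[ℝ] V}
    (hg : g ∈ pairStabilizer K S) :
    b * ⟪e 1, g (e 0)⟫_ℝ + d * ⟪e 2, g (e 0)⟫_ℝ = a * ⟪e 1, g (e 0)⟫_ℝ ∧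
    d * ⟪e 1, g (e 0)⟫_ℝ + c * ⟪e 2, g (e 0)⟫_ℝ = a * ⟪e 2, g (e 0)⟫_ℝ := by
  have h := hg.2.2 (e 0)
  rw [hS.s0, map_smul] at h
  rw [← hS.inner_one, ← hS.inner_two, h, inner_smul_right, inner_smul_right]
  exact ⟨rfl, rfl⟩

/-- Here `e 0` spans a simple eigenline of `S`, which every map commuting with `S` preserves. -/
theorem IsBlock.mem_axisGroup {a b c : ℝ} (hS : IsBlock e S a b c 0) (hab : a ≠ b) (hac : a ≠ c)
    {g : V ≃ₗᵢ[ℝ] V} (hg : g ∈ pairStabilizer K S) : g ∈ axisGroup e := by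
  obtain ⟨h1, h2⟩ := hS.image_eigenvector hg
  refine ⟨hg.1, image_eq_of_inner_eq_zero ?_ ?_⟩
  · exact (mul_eq_zero.1 (by linarith : (a - b) * ⟪e 1, g (e 0)⟫_ℝ = 0)).resolve_left
      (sub_ne_zero.2 hab)
  · exact (mul_eq_zero.1 (by linarith : (a - c) * ⟪e 2, g (e 0)⟫_ℝ = 0)).resolve_left
      (sub_ne_zero.2 hac)

/-- The condition says that `S` is not scalar on the plane, and only the rotations ±1 commute with a
non-scalar symmetric operator there. -/
theorem IsBlock.sin_eq_zero {a b c d : ℝ} (hS : IsBlock e S a b c d)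
    (h : (b - c) ^ 2 + d ^ 2 ≠ 0) {θ : ℝ} (hg : axisRotation e 0 θ ∈ pairStabilizer K S) :
    Real.sin θ = 0 := by
  have h' := congrArg (fun x => ⟪e 1, x⟫_ℝ) (hg.2.2 (e 1))
  have h'' := congrArg (fun x => ⟪e 2, x⟫_ℝ) (hg.2.2 (e 1))
  simp [hS.s1, hS.s2, inner_add_right, inner_smul_right, inner_basis,
    -inner_self_eq_norm_sq_to_K] at h' h''
  by_contra hs
  have hd : d = 0 := by
    have : Real.sin θ * (2 * d) = 0 := by linarith
    simpa [hs] using this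
  have hbc : b - c = 0 := by
    have : Real.sin θ * (b - c) = 0 := by rw [hd] at h''; linarith
    simpa [hs] using this
  exact h (by rw [hd, hbc]; ring)

theorem axisRotation_eq_of_sin_eq_zero {θ : ℝ} (h : Real.sin θ = 0) (i : Fin 3) :
    axisRotation e i θ = 1 ∨ axisRotation e i θ = halfTurn e i := by
  have hc := Real.cos_sq_add_sin_sq θ
  rw [h, zero_pow two_ne_zero, add_zero] at hc
  rcases mul_self_eq_one_iff.1 ((sq _).symm.trans hc) with h0 | h0
  · left
    apply isometry_ext e <;> fin_cases i <;> simp [h, h0]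
  · right
    apply isometry_ext e <;> fin_cases i <;> simp [h, h0, halfTurn]

/-! ### The trace form -/

/-- The invariant bilinear form `trace (K_x ∘ K_y)`. -/
noncomputable def traceForm (K : V →ₗ[ℝ] V →ₗ[ℝ] V) (x y : V) : ℝ :=
  LinearMap.trace ℝ V (K x ∘ₗ K y)

/-- Equivariance of `K` means `K_{gx} = g K_x g⁻¹`, and the trace is invariant under conjugation. -/
theorem traceForm_invariant {g : V ≃ₗᵢ[ℝ] V} (hg : g ∈ pairStabilizer K S) (x y : V) :
    traceForm K (g x) (g y) = traceForm K x y := by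
  have h : ∀ x, K (g x) = g.toLinearEquiv.conj (K x) := fun x => by
    ext z
    rw [LinearEquiv.conj_apply_apply]
    change K (g x) z = g (K x (g.symm z))
    rw [← hg.2.1, LinearIsometryEquiv.apply_symm_apply]
  rw [traceForm, h, h, ← LinearEquiv.conj_comp, LinearMap.trace_conj']
  rfl

theorem traceForm_image {g : V ≃ₗᵢ[ℝ] V} (hg : g ∈ pairStabilizer K S) {α : ℝ} {x : V}
    (hα : ∀ y, traceForm K x y = α * ⟪x, y⟫_ℝ) (y : V) :
    traceForm K (g x) y = α * ⟪g x, y⟫_ℝ := by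
  conv_lhs => rw [← g.apply_symm_apply y, traceForm_invariant hg, hα]
  rw [← g.inner_map_map, g.apply_symm_apply]

theorem traceForm_eq_sum (e : OrthonormalBasis (Fin 3) ℝ V) (K : V →ₗ[ℝ] V →ₗ[ℝ] V) (x y : V) :
    traceForm K x y = ⟪e 0, K x (K y (e 0))⟫_ℝ + ⟪e 1, K x (K y (e 1))⟫_ℝ +
      ⟪e 2, K x (K y (e 2))⟫_ℝ := by
  rw [traceForm, LinearMap.trace_eq_sum_inner _ e, Fin.sum_univ_three]
  rfl

theorem traceForm_expand_left (e : OrthonormalBasis (Fin 3) ℝ V) (K : V →ₗ[ℝ] V →ₗ[ℝ] V)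
    (x y : V) : traceForm K x y = ⟪e 0, x⟫_ℝ * traceForm K (e 0) y +
      ⟪e 1, x⟫_ℝ * traceForm K (e 1) y + ⟪e 2, x⟫_ℝ * traceForm K (e 2) y := by
  conv_lhs => rw [expand e x]
  simp only [traceForm, map_add, map_smul, LinearMap.add_comp, LinearMap.smul_comp, smul_eq_mul]

theorem traceForm_comm (K : V →ₗ[ℝ] V →ₗ[ℝ] V) (x y : V) : traceForm K x y = traceForm K y x :=
  LinearMap.trace_mul_comm ℝ (K x) (K y)

theorem IsAxial.traceForm_basis {l m : ℝ} (hK : IsAxial e K l m) :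
    traceForm K (e 0) (e 0) = 6 * l ^ 2 ∧ traceForm K (e 0) (e 1) = 0 ∧
    traceForm K (e 0) (e 2) = 0 ∧ traceForm K (e 1) (e 1) = 2 * l ^ 2 + 2 * m ^ 2 ∧
    traceForm K (e 1) (e 2) = 0 ∧ traceForm K (e 2) (e 2) = 2 * l ^ 2 + 2 * m ^ 2 := by
  obtain ⟨k00, k01, k02, k10, k11, k12, k20, k21, k22⟩ := hK
  simp only [traceForm_eq_sum e]
  simp [k00, k01, k02, k10, k11, k12, k20, k21, k22, inner_add_right, inner_smul_right,
    inner_basis, -inner_self_eq_norm_sq_to_K]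
  refine ⟨?_, ?_, ?_⟩ <;> ring

theorem IsMixed.traceForm_basis {l m : ℝ} (hK : IsMixed e K l m) :
    traceForm K (e 0) (e 0) = 6 * l ^ 2 + 2 * m ^ 2 ∧ traceForm K (e 0) (e 1) = 0 ∧
    traceForm K (e 0) (e 2) = 0 ∧ traceForm K (e 1) (e 1) = 2 * l ^ 2 + 2 * m ^ 2 ∧
    traceForm K (e 1) (e 2) = -(4 * l * m) ∧
    traceForm K (e 2) (e 2) = 2 * l ^ 2 + 2 * m ^ 2 := by
  obtain ⟨k00, k01, k02, k10, k11, k12, k20, k21, k22⟩ := hK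
  simp only [traceForm_eq_sum e]
  simp [k00, k01, k02, k10, k11, k12, k20, k21, k22, inner_add_right, inner_smul_right,
    inner_basis, -inner_self_eq_norm_sq_to_K]
  refine ⟨?_, ?_, ?_, ?_⟩ <;> ring

/-- If `e 0` is an eigenvector of the trace form, then so is its image. -/
theorem traceForm_image_zero {g : V ≃ₗᵢ[ℝ] V} (hg : g ∈ pairStabilizer K S) {α : ℝ}
    (h0 : traceForm K (e 0) (e 0) = α) (h1 : traceForm K (e 0) (e 1) = 0)
    (h2 : traceForm K (e 0) (e 2) = 0) (j : Fin 3) :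
    ⟪e 0, g (e 0)⟫_ℝ * traceForm K (e 0) (e j) + ⟪e 1, g (e 0)⟫_ℝ * traceForm K (e 1) (e j) +
      ⟪e 2, g (e 0)⟫_ℝ * traceForm K (e 2) (e j) = α * ⟪e j, g (e 0)⟫_ℝ := by
  rw [← traceForm_expand_left, real_inner_comm]
  refine traceForm_image hg (fun y => ?_) (e j)
  rw [traceForm_comm, traceForm_expand_left e, h0, traceForm_comm K (e 1), h1,
    traceForm_comm K (e 2), h2]
  ring

/-- The trace form has eigenvalue `6 l²` on `e 0` and `2 l² + 2 m²` on the plane. These differ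
exactly when `m² ≠ 2 l²`, and then the line of `e 0` is distinguished. -/
theorem IsAxial.mem_axisGroup {l m : ℝ} (hK : IsAxial e K l m) (hlm : m ^ 2 ≠ 2 * l ^ 2)
    {g : V ≃ₗᵢ[ℝ] V} (hg : g ∈ pairStabilizer K S) : g ∈ axisGroup e := by
  obtain ⟨t00, t01, t02, t11, t12, t22⟩ := hK.traceForm_basis
  have h1 := traceForm_image_zero hg t00 t01 t02 1
  have h2 := traceForm_image_zero hg t00 t01 t02 2
  rw [traceForm_comm K (e 2), t01, t11, t12] at h1
  rw [t02, t12, t22] at h2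
  have hne : m ^ 2 - 2 * l ^ 2 ≠ 0 := sub_ne_zero.2 hlm
  refine ⟨hg.1, image_eq_of_inner_eq_zero ?_ ?_⟩
  · exact (mul_eq_zero.1 (by linarith :
      (m ^ 2 - 2 * l ^ 2) * ⟪e 1, g (e 0)⟫_ℝ = 0)).resolve_left hne
  · exact (mul_eq_zero.1 (by linarith :
      (m ^ 2 - 2 * l ^ 2) * ⟪e 2, g (e 0)⟫_ℝ = 0)).resolve_left hne

/-- The trace form has eigenvalue `6 l² + 2 m²` on `e 0`, and `2 (l - m)²`, `2 (l + m)²` on `e 1 + e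
2`, `e 1 - e 2`. The differences `4 l (l + m)` and `4 l (l - m)` are nonzero under the hypotheses.
-/
theorem IsMixed.mem_axisGroup {l m : ℝ} (hK : IsMixed e K l m) (hl : l ≠ 0) (hlm : l ^ 2 ≠ m ^ 2)
    {g : V ≃ₗᵢ[ℝ] V} (hg : g ∈ pairStabilizer K S) : g ∈ axisGroup e := by
  obtain ⟨t00, t01, t02, t11, t12, t22⟩ := hK.traceForm_basis
  have h1 := traceForm_image_zero hg t00 t01 t02 1
  have h2 := traceForm_image_zero hg t00 t01 t02 2
  rw [traceForm_comm K (e 2), t01, t11, t12] at h1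
  rw [t02, t12, t22] at h2
  have hne : l ^ 2 - m ^ 2 ≠ 0 := sub_ne_zero.2 hlm
  have h1' : l * ⟪e 1, g (e 0)⟫_ℝ + m * ⟪e 2, g (e 0)⟫_ℝ = 0 := by
    have : l * (l * ⟪e 1, g (e 0)⟫_ℝ + m * ⟪e 2, g (e 0)⟫_ℝ) = 0 := by linarith
    simpa [hl] using this
  have h2' : m * ⟪e 1, g (e 0)⟫_ℝ + l * ⟪e 2, g (e 0)⟫_ℝ = 0 := by
    have : l * (m * ⟪e 1, g (e 0)⟫_ℝ + l * ⟪e 2, g (e 0)⟫_ℝ) = 0 := by linarith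
    simpa [hl] using this
  refine ⟨hg.1, image_eq_of_inner_eq_zero ?_ ?_⟩
  · exact (mul_eq_zero.1 (by linear_combination l * h1' - m * h2' :
      (l ^ 2 - m ^ 2) * ⟪e 1, g (e 0)⟫_ℝ = 0)).resolve_left hne
  · exact (mul_eq_zero.1 (by linear_combination l * h2' - m * h1' :
      (l ^ 2 - m ^ 2) * ⟪e 2, g (e 0)⟫_ℝ = 0)).resolve_left hne

/-- A symmetry preserving the axis fixes `e 0` if the cubic form does not vanish there. -/
theorem image_zero_of_mem_axisGroup {g : V ≃ₗᵢ[ℝ] V} (hg : g ∈ pairStabilizer K S)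
    (hax : g ∈ axisGroup e) (h0 : ⟪K (e 0) (e 0), e 0⟫_ℝ ≠ 0) : g (e 0) = e 0 := by
  refine hax.2.resolve_right fun h => h0 ?_
  have := cubic_invariant hg (e 0)
  rw [h] at this
  simp only [map_neg, LinearMap.neg_apply, neg_neg, inner_neg_right] at this
  linarith

theorem IsAxial.cubic_zero {l m : ℝ} (hK : IsAxial e K l m) (hl : l ≠ 0) :
    ⟪K (e 0) (e 0), e 0⟫_ℝ ≠ 0 := by
  rw [hK.k00]; simpa [inner_smul_left, inner_basis, -inner_self_eq_norm_sq_to_K]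

theorem IsMixed.cubic_zero {l m : ℝ} (hK : IsMixed e K l m) (hl : l ≠ 0) :
    ⟪K (e 0) (e 0), e 0⟫_ℝ ≠ 0 := by
  rw [hK.k00]; simpa [inner_smul_left, inner_basis, -inner_self_eq_norm_sq_to_K]

/-- A rotation angle compatible with a cubic term of order three is a multiple of `2π/3`. -/
theorem axisRotation_mem_zpowers {θ : ℝ} (i : Fin 3)
    (h : Real.cos θ ^ 3 - 3 * Real.cos θ * Real.sin θ ^ 2 = 1) :
    axisRotation e i θ ∈ Subgroup.zpowers (thirdTurn e i) := by
  have h3 : Real.cos (3 * θ) = 1 := by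
    rw [Real.cos_three_mul, ← h, Real.sin_sq]; ring
  obtain ⟨n, hn⟩ := (Real.cos_eq_one_iff _).1 h3
  have : θ = n * (2 * π / 3) := by linarith
  rw [this, axisRotation_intCast_mul]
  exact ⟨n, rfl⟩

end

/-! ### The stabilizers of the canonical forms -/

section
variable {e : OrthonormalBasis (Fin 3) ℝ V} {K : V →ₗ[ℝ] V →ₗ[ℝ] V} {S : V →ₗ[ℝ] V}

theorem thirdTurn_pow_three (e : OrthonormalBasis (Fin 3) ℝ V) (i : Fin 3) :
    thirdTurn e i ^ 3 = 1 := by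
  rw [thirdTurn, ← axisRotation_natCast_mul]
  have : ((3 : ℕ) : ℝ) * (2 * π / 3) = 2 * π := by push_cast; ring
  rw [this]
  apply isometry_ext e <;> fin_cases i <;> simp

theorem thirdTurn_ne_one (e : OrthonormalBasis (Fin 3) ℝ V) (i : Fin 3) : thirdTurn e i ≠ 1 := by
  intro h
  have h' := congrArg (fun g : V ≃ₗᵢ[ℝ] V => ⟪e (i + 1), g (e (i + 1))⟫_ℝ) h
  fin_cases i <;> simp [thirdTurn, cos_two_pi_div_three, inner_add_right, inner_smul_right,
    inner_basis, -inner_self_eq_norm_sq_to_K] at h' <;> norm_num at h'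

theorem halfTurn_ne_one (e : OrthonormalBasis (Fin 3) ℝ V) (i : Fin 3) : halfTurn e i ≠ 1 := by
  intro h
  have h' := congrArg (fun g : V ≃ₗᵢ[ℝ] V => ⟪e (i + 1), g (e (i + 1))⟫_ℝ) h
  fin_cases i <;> simp [halfTurn, inner_basis, -inner_self_eq_norm_sq_to_K] at h' <;>
    norm_num at h'

theorem stabilizer_formI (h : FormI e K S) : pairStabilizer K S = rotationGroup V := by
  obtain ⟨a, rfl, hS⟩ := (formI_iff e K S).1 h
  refine le_antisymm (fun g hg => hg.1) fun g hg => ⟨hg, by simp, ?_⟩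
  have : S = a • LinearMap.id := linearMap_ext e (by simp [hS.s0]) (by simp [hS.s1])
    (by simp [hS.s2])
  simp [this]

theorem stabilizer_formII (h : FormII e K S) : pairStabilizer K S = axisGroup e := by
  obtain ⟨a, b, hab, rfl, hS⟩ := (formII_iff e K S).1 h
  refine le_antisymm (fun g hg => hS.mem_axisGroup hab hab hg) ?_
  -- The zero form belongs to both families, so the generator lemmas of both apply.
  have hA : IsAxial e (0 : V →ₗ[ℝ] V →ₗ[ℝ] V) 0 0 := by constructor <;> simp
  have hM : IsMixed e (0 : V →ₗ[ℝ] V →ₗ[ℝ] V) 0 0 := by constructor <;> simp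
  rw [axisGroup_eq_closure, Subgroup.closure_le]
  rintro _ (⟨θ, rfl⟩ | rfl)
  · exact axisRotation_mem_of_axial hA hS θ
  · exact halfTurn_one_mem_of_mixed hM hS

theorem mem_stabilizer_formIII (h : FormIII e K S) (g : V ≃ₗᵢ[ℝ] V) :
    g ∈ pairStabilizer K S ↔ g ∈ rotationGroup V ∧ g (e 0) = e 0 := by
  obtain ⟨l, a, b, hl, hK, hS⟩ := (formIII_iff e K S).1 h
  constructor
  · intro hg
    refine ⟨hg.1, image_zero_of_mem_axisGroup hg (hK.mem_axisGroup ?_ hg) (hK.cubic_zero hl.ne')⟩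
    have := pow_pos hl 2
    exact fun h => by linarith
  · rintro ⟨hg, h0⟩
    obtain ⟨θ, rfl⟩ := exists_eq_axisRotation e 0 hg h0
    exact axisRotation_mem_of_axial hK hS θ

theorem stabilizer_formIII (h : FormIII e K S) :
    (pairStabilizer K S : Set (V ≃ₗᵢ[ℝ] V)) = Set.range (axisRotation e 0) := by
  ext g
  rw [SetLike.mem_coe, mem_stabilizer_formIII h]
  constructor
  · rintro ⟨hg, h0⟩
    obtain ⟨θ, rfl⟩ := exists_eq_axisRotation e 0 hg h0
    exact ⟨θ, rfl⟩
  · rintro ⟨θ, rfl⟩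
    exact ⟨axisRotation_mem_rotationGroup e 0 θ, by simp⟩

/-- The equality case of the arithmetic-geometric mean inequality for the three squares. -/
theorem sq_eq_one_of_sum_of_prod {x y z : ℝ} (hs : x ^ 2 + y ^ 2 + z ^ 2 = 3)
    (hp : x * y * z = 1) : x ^ 2 = 1 ∧ y ^ 2 = 1 ∧ z ^ 2 = 1 := by
  have hp2 : x ^ 2 * y ^ 2 * z ^ 2 = 1 := by rw [← mul_pow, ← mul_pow, hp, one_pow]
  have hx := sq_nonneg x
  have hy := sq_nonneg y
  have hz := sq_nonneg z
  generalize x ^ 2 = A at *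
  generalize y ^ 2 = B at *
  generalize z ^ 2 = C at *
  -- The left side is `(A + B + C)³ - 27 A B C` written as a sum of nonnegative terms, using `A + B
  -- + C = 3`.
  have hid : 3 / 2 * ((A - B) ^ 2 + (B - C) ^ 2 + (C - A) ^ 2) +
      3 * (A * (B - C) ^ 2 + B * (C - A) ^ 2 + C * (A - B) ^ 2) = 0 := by
    have hC : C = 3 - A - B := by linarith
    subst hC
    linear_combination -27 * hp2
  have h1 := mul_nonneg hx (sq_nonneg (B - C))
  have h2 := mul_nonneg hy (sq_nonneg (C - A))
  have h3 := mul_nonneg hz (sq_nonneg (A - B))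
  have hAB : A - B = 0 := by
    apply pow_eq_zero_iff two_ne_zero |>.1
    linarith [sq_nonneg (A - B), sq_nonneg (B - C), sq_nonneg (C - A)]
  have hBC : B - C = 0 := by
    apply pow_eq_zero_iff two_ne_zero |>.1
    linarith [sq_nonneg (A - B), sq_nonneg (B - C), sq_nonneg (C - A)]
  refine ⟨?_, ?_, ?_⟩ <;> linarith

/-- The cubic form is `6 m x₀ x₁ x₂`. On the sphere of radius `√3` the product is at most 1, with
equality only at the four vertices of the tetrahedron, so a symmetry permutes these. -/
theorem IsMixed.exists_word {m : ℝ} (hK : IsMixed e K 0 m) (hm : m ≠ 0) {g : V ≃ₗᵢ[ℝ] V}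
    (hg : g ∈ pairStabilizer K S) : ∃ (a b : Fin 2) (c : Fin 3),
      g = halfTurn e 0 ^ (a : ℕ) * halfTurn e 1 ^ (b : ℕ) * diagonalTurn e ^ (c : ℕ) := by
  refine exists_word_of_maps_tetrahedron e hg.1 fun i => ?_
  have hsum : ⟪e 0, g (tetrahedron e i)⟫_ℝ ^ 2 + ⟪e 1, g (tetrahedron e i)⟫_ℝ ^ 2 +
      ⟪e 2, g (tetrahedron e i)⟫_ℝ ^ 2 = 3 := by
    have h := inner_expand e (g (tetrahedron e i)) (g (tetrahedron e i))
    rw [LinearIsometryEquiv.inner_map_map, inner_tetrahedron, if_pos rfl] at h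
    rw [h]; ring
  have hprod : ⟪e 0, g (tetrahedron e i)⟫_ℝ * ⟪e 1, g (tetrahedron e i)⟫_ℝ *
      ⟪e 2, g (tetrahedron e i)⟫_ℝ = 1 := by
    have h := cubic_invariant hg (tetrahedron e i)
    rw [hK.cubic, hK.cubic] at h
    have h1 : ⟪e 0, tetrahedron e i⟫_ℝ * ⟪e 1, tetrahedron e i⟫_ℝ * ⟪e 2, tetrahedron e i⟫_ℝ =
        1 := by
      fin_cases i <;> simp [tetrahedron, inner_add_right, inner_sub_right, inner_basis,
        -inner_self_eq_norm_sq_to_K]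
    rw [h1] at h
    exact mul_left_cancel₀ (mul_ne_zero (by norm_num : (6 : ℝ) ≠ 0) hm) (by linarith)
  obtain ⟨h0, h1, h2⟩ := sq_eq_one_of_sum_of_prod hsum hprod
  have hexp := expand e (g (tetrahedron e i))
  generalize ⟪e 0, g (tetrahedron e i)⟫_ℝ = x at *
  generalize ⟪e 1, g (tetrahedron e i)⟫_ℝ = y at *
  generalize ⟪e 2, g (tetrahedron e i)⟫_ℝ = z at *
  rw [hexp, Fin.exists_fin_succ, Fin.exists_fin_succ, Fin.exists_fin_two]
  rw [sq, mul_self_eq_one_iff] at h0 h1 h2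
  rcases h0 with rfl | rfl <;> rcases h1 with rfl | rfl <;> rcases h2 with rfl | rfl <;>
    norm_num at hprod
  · exact Or.inl (by simp [tetrahedron])
  · exact Or.inr (Or.inl (by simp [tetrahedron]; abel))
  · exact Or.inr (Or.inr (Or.inl (by simp [tetrahedron]; abel)))
  · exact Or.inr (Or.inr (Or.inr (by simp [tetrahedron]; abel)))

theorem stabilizer_formIV (h : FormIV e K S) : pairStabilizer K S =
    Subgroup.closure {halfTurn e 0, halfTurn e 1, diagonalTurn e} := by
  obtain ⟨l, a, hl, hK, hS⟩ := (formIV_iff e K S).1 h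
  apply le_antisymm
  · intro g hg
    obtain ⟨i, j, k, rfl⟩ := hK.exists_word hl.ne' hg
    refine mul_mem (mul_mem ?_ ?_) ?_ <;> refine pow_mem (Subgroup.subset_closure ?_) _ <;> simp
  · rw [Subgroup.closure_le]
    rintro _ (rfl | rfl | rfl)
    · exact halfTurn_zero_mem_of_mixed hK hS
    · exact halfTurn_one_mem_of_mixed hK hS
    · exact diagonalTurn_mem_of_mixed hK hS

/-- The axis is `e 2`, the kernel of `x ↦ K_x`. A symmetry reversing it is composed with `P₁`; a
rotation about it must satisfy `cos 3θ = 1`. -/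
theorem stabilizer_formV (h : FormV e K S) :
    pairStabilizer K S = Subgroup.closure {halfTurn e 0, thirdTurn e 2} := by
  obtain ⟨l, a, b, hl, hK, hS⟩ := (formV_iff e K S).1 h
  have hP := halfTurn_zero_mem_of_planar hK hS
  have hRot : ∀ g ∈ pairStabilizer K S, g (e 2) = e 2 →
      g ∈ Subgroup.closure {halfTurn e 0, thirdTurn e 2} := by
    intro g hg h2
    obtain ⟨θ, rfl⟩ := exists_eq_axisRotation e 2 hg.1 h2
    have hc := cubic_invariant hg (e 0)
    rw [hK.cubic, hK.cubic] at hc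
    simp [inner_add_right, inner_smul_right, inner_basis, -inner_self_eq_norm_sq_to_K] at hc
    have hθ : Real.cos θ ^ 3 - 3 * Real.cos θ * Real.sin θ ^ 2 = 1 :=
      mul_left_cancel₀ hl.ne' (by linarith)
    refine Subgroup.zpowers_le.2 ?_ (axisRotation_mem_zpowers 2 hθ)
    exact Subgroup.subset_closure (by simp)
  apply le_antisymm
  · intro g hg
    -- From `K_{e₂} = 0` follows `K_{g e₂} = 0`. Evaluating at `e 0` alone already forces `g (e 2)`
    -- onto the line of `e 2`.
    have hker : K (g (e 2)) (e 0) = 0 := by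
      have h := hg.2.1 (e 2) (g.symm (e 0))
      rw [g.apply_symm_apply, expand e (g.symm (e 0))] at h
      simpa [hK.k20, hK.k21, hK.k22] using h
    rw [expand e (g (e 2))] at hker
    simp only [map_add, map_smul, LinearMap.add_apply, LinearMap.smul_apply, hK.k00, hK.k10,
      hK.k20] at hker
    have h0 := congrArg (fun x => ⟪e 0, x⟫_ℝ) hker
    have h1 := congrArg (fun x => ⟪e 1, x⟫_ℝ) hker
    simp [inner_add_right, inner_smul_right, inner_basis, -inner_self_eq_norm_sq_to_K,
      hl.ne'] at h0 h1
    have hn := sq_add_sq_add_sq_image e g 2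
    rw [h0, h1] at hn
    have hn' : ⟪e 2, g (e 2)⟫_ℝ * ⟪e 2, g (e 2)⟫_ℝ = 1 := by linarith
    have hexp := expand e (g (e 2))
    rw [h0, h1] at hexp
    rcases mul_self_eq_one_iff.1 hn' with h2 | h2
    · exact hRot g hg (by rw [hexp, h2]; simp)
    · have := hRot _ (mul_mem hP hg) (by
        rw [LinearIsometryEquiv.coe_mul, Function.comp_apply, hexp, h2]
        simp [(halfTurn_zero_basis e).2.2])
      rw [← one_mul g, ← halfTurn_mul_self e 0, mul_assoc]
      exact mul_mem (Subgroup.subset_closure (by simp)) this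
  · rw [Subgroup.closure_le]
    rintro _ (rfl | rfl)
    · exact hP
    · exact thirdTurn_two_mem_of_planar hK hS

/-- For `λ > 0` the stabilizer lies in the tetrahedral group and contains the Klein four-group;
anything more would bring in `Q`, which permutes the eigenlines cyclically and forces `a = b = c`.
For `λ = 0` the three simple eigenlines of `S` decide. -/
theorem stabilizer_formVI (h : FormVI e K S) :
    pairStabilizer K S = Subgroup.closure {halfTurn e 0, halfTurn e 1} := by
  obtain ⟨l, a, b, c, hcond, hK, hS⟩ := (formVI_iff e K S).1 h
  have hP0 := halfTurn_zero_mem_of_mixed hK hS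
  have hP1 := halfTurn_one_mem_of_mixed hK hS
  have hC0 : halfTurn e 0 ∈ Subgroup.closure {halfTurn e 0, halfTurn e 1} :=
    Subgroup.subset_closure (by simp)
  have hC1 : halfTurn e 1 ∈ Subgroup.closure {halfTurn e 0, halfTurn e 1} :=
    Subgroup.subset_closure (by simp)
  apply le_antisymm
  · intro g hg
    rcases hcond with ⟨hl, hne⟩ | ⟨-, hab, hbc, hac⟩
    · have hQ : diagonalTurn e ∉ pairStabilizer K S := fun hQ => by
        obtain ⟨q0, q1, q2⟩ := diagonalTurn_basis e
        have h0 := congrArg (fun x => ⟪e 1, x⟫_ℝ) (hQ.2.2 (e 0))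
        have h1 := congrArg (fun x => ⟪e 2, x⟫_ℝ) (hQ.2.2 (e 1))
        simp [q0, q1, hS.s0, hS.s1, hS.s2, inner_smul_right, inner_basis,
          -inner_self_eq_norm_sq_to_K] at h0 h1
        exact hne ⟨h0.symm, h1.symm⟩
      obtain ⟨i, j, k, rfl⟩ := hK.exists_word hl.ne' hg
      have hk := (Subgroup.mul_mem_cancel_left _ (mul_mem (pow_mem hP0 _) (pow_mem hP1 _))).1 hg
      have hQ3 : diagonalTurn e ^ 3 = 1 := by
        rw [diagonalTurn_eq, ← map_pow, show (Equiv.swap 1 2 * Equiv.swap 2 3 :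
          Equiv.Perm (Fin 4)) ^ 3 = 1 by decide, map_one]
      have hk0 : k = 0 := by
        fin_cases k
        · rfl
        · exact absurd (by simpa using hk) hQ
        -- As `Q` has order three, `Q = (Q²)²`, so `Q²` in the stabilizer puts `Q` there too.
        · refine absurd ?_ hQ
          have h2 := pow_mem hk 2
          have h3 : (diagonalTurn e ^ 2) ^ 2 = diagonalTurn e := by
            rw [← pow_mul, show 2 * 2 = 3 + 1 from rfl, pow_succ, hQ3, one_mul]
          change (diagonalTurn e ^ 2) ^ 2 ∈ _ at h2
          rwa [h3] at h2
      subst hk0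
      simpa using mul_mem (pow_mem hC0 _) (pow_mem hC1 _)
    · have hsin : ∀ θ, axisRotation e 0 θ ∈ pairStabilizer K S →
          axisRotation e 0 θ ∈ Subgroup.closure {halfTurn e 0, halfTurn e 1} := fun θ hθ => by
        have := sub_ne_zero.2 hbc
        rcases axisRotation_eq_of_sin_eq_zero (e := e) (hS.sin_eq_zero (by positivity) hθ) 0
          with h | h <;> rw [h]
        · exact one_mem _
        · exact hC0
      obtain ⟨θ, rfl | rfl⟩ := (mem_axisGroup_iff e g).1 (hS.mem_axisGroup hab hac hg)
      · exact hsin θ hg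
      · exact mul_mem hC1 (hsin θ ((Subgroup.mul_mem_cancel_left _ hP1).1 hg))
  · rw [Subgroup.closure_le]
    rintro _ (rfl | rfl)
    · exact hP0
    · exact hP1

/-- The axis is found by the trace form when `m ≠ √2 λ`. At `m = √2 λ` the trace form is scalar, and
the simple eigenvalue `a ≠ b` of `S` takes over. The value of the cubic at the image of `e 1` is `m
cos 3θ`. -/
theorem stabilizer_formVII (h : FormVII e K S) :
    pairStabilizer K S = Subgroup.closure {thirdTurn e 0} := by
  obtain ⟨l, m, a, b, hcond, hK, hS⟩ := (formVII_iff e K S).1 h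
  have h2 : √2 ^ 2 = (2 : ℝ) := Real.sq_sqrt (by norm_num)
  have h2pos : 0 < √2 := by positivity
  obtain ⟨hl, hm⟩ : 0 < l ∧ 0 < m := by
    rcases hcond with ⟨hl, hm, -⟩ | ⟨rfl, hlm, -⟩
    · exact ⟨hl, hm⟩
    · exact ⟨pos_of_mul_pos_right hlm h2pos.le, hlm⟩
  apply le_antisymm
  · intro g hg
    have hax : g ∈ axisGroup e := by
      rcases hcond with ⟨-, -, hne⟩ | ⟨-, -, hab⟩
      · refine hK.mem_axisGroup (fun hsq => hne ?_) hg
        rw [← h2, ← mul_pow] at hsq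
        exact (pow_left_inj₀ hm.le (by positivity) two_ne_zero).1 hsq
      · exact hS.mem_axisGroup hab hab hg
    obtain ⟨θ, rfl⟩ := exists_eq_axisRotation e 0 hg.1
      (image_zero_of_mem_axisGroup hg hax (hK.cubic_zero hl.ne'))
    have hc := cubic_invariant hg (e 1)
    rw [hK.cubic, hK.cubic] at hc
    simp [inner_add_right, inner_smul_right, inner_basis, -inner_self_eq_norm_sq_to_K] at hc
    have hθ : Real.cos θ ^ 3 - 3 * Real.cos θ * Real.sin θ ^ 2 = 1 :=
      mul_left_cancel₀ hm.ne' (by linarith)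
    rw [← Subgroup.zpowers_eq_closure]
    exact axisRotation_mem_zpowers 0 hθ
  · rw [Subgroup.closure_le, Set.singleton_subset_iff]
    exact thirdTurn_zero_mem_of_axial hK hS

end

section
variable {e : OrthonormalBasis (Fin 3) ℝ V} {K : V →ₗ[ℝ] V →ₗ[ℝ] V} {S : V →ₗ[ℝ] V}

/-- For `l = m` the kernel of `x ↦ K_x` is the line of `e 1 + e 2`, so symmetries preserve this line
and send `e 0` into its orthogonal plane. There, `S` singles out `e 0` up to sign, and the cubic
form fixes the sign. -/
theorem IsMixed.image_zero_of_eq {m a b c d : ℝ} (hK : IsMixed e K m m) (hm : 0 < m)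
    (hS : IsBlock e S a b c d) (hne : (b - c) ^ 2 + (b + c - 2 * a - 2 * d) ^ 2 ≠ 0)
    {g : V ≃ₗᵢ[ℝ] V} (hg : g ∈ pairStabilizer K S) : g (e 0) = e 0 := by
  have hker : K (g (e 1 + e 2)) (e 0) = 0 := by
    have h := hg.2.1 (e 1 + e 2) (g.symm (e 0))
    rw [g.apply_symm_apply, expand e (g.symm (e 0))] at h
    rw [h]
    simp only [map_add, map_smul, LinearMap.add_apply, hK.k10, hK.k20, hK.k11, hK.k21,
      hK.k12, hK.k22]
    module
  have horth : ⟪g (e 0), g (e 1 + e 2)⟫_ℝ = 0 := by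
    rw [LinearIsometryEquiv.inner_map_map]; simp [inner_add_right]
  have hnorm : ⟪g (e 1 + e 2), g (e 1 + e 2)⟫_ℝ = 2 := by
    rw [LinearIsometryEquiv.inner_map_map]
    simp [inner_add_right, inner_add_left, inner_basis, -inner_self_eq_norm_sq_to_K]
    norm_num
  generalize g (e 1 + e 2) = w at hker horth hnorm
  rw [inner_expand e] at horth hnorm
  rw [expand e w] at hker
  simp only [map_add, map_smul, LinearMap.add_apply, LinearMap.smul_apply, hK.k00, hK.k10,
    hK.k20] at hker
  have h0 := congrArg (fun x => ⟪e 0, x⟫_ℝ) hker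
  have h1 := congrArg (fun x => ⟪e 1, x⟫_ℝ) hker
  simp only [inner_add_right, inner_smul_right, inner_basis, inner_zero_right, smul_add] at h0 h1
  simp [hm.ne'] at h0 h1
  have h12 : ⟪e 1, w⟫_ℝ = ⟪e 2, w⟫_ℝ := mul_left_cancel₀ hm.ne' (by linarith)
  rw [h0, h12] at horth hnorm
  have hw : ⟪e 2, w⟫_ℝ ≠ 0 := fun h => by rw [h] at hnorm; norm_num at hnorm
  have hx : ⟪e 2, g (e 0)⟫_ℝ = -⟪e 1, g (e 0)⟫_ℝ := mul_right_cancel₀ hw (by linarith)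
  obtain ⟨hS1, hS2⟩ := hS.image_eigenvector hg
  have hn := sq_add_sq_add_sq_image e g 0
  have hc := cubic_invariant hg (e 0)
  rw [hK.cubic, hK.cubic] at hc
  -- Otherwise `e 1 - e 2` would also be an eigenvector of `S` for `a`, that is `b - d = a = c - d`,
  -- which `hne` excludes.
  have hx1 : ⟪e 1, g (e 0)⟫_ℝ = 0 := by
    by_contra hx1
    rw [hx] at hS1 hS2
    have hb : b - d = a := mul_right_cancel₀ hx1 (by linarith)
    have hc' : c - d = a := mul_right_cancel₀ hx1 (by linarith)
    exact hne (by rw [← hb, show b = c by linarith]; ring)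
  rw [hx1, neg_zero] at hx
  refine (image_eq_of_inner_eq_zero hx1 hx).resolve_right fun h => ?_
  rw [h] at hc
  simp [inner_basis, -inner_self_eq_norm_sq_to_K] at hc
  linarith

/-- The symmetry is tetrahedral, and `P₁` may be divided out, leaving `P₂^j Q^k`. A power of `Q`
with `k ≠ 0` moves the eigenvector `e 0` to `±e 1` or `±e 2`, and `P₂` reverses the sign of `d`;
both contradict `d ≠ 0`. -/
theorem IsMixed.image_zero_of_zero {m a b c d : ℝ} (hK : IsMixed e K 0 m) (hm : 0 < m)
    (hS : IsBlock e S a b c d) (hd : d ≠ 0) {g : V ≃ₗᵢ[ℝ] V} (hg : g ∈ pairStabilizer K S) :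
    g (e 0) = e 0 := by
  obtain ⟨p0, p1, p2⟩ := halfTurn_zero_basis e
  obtain ⟨q0, q1, q2⟩ := halfTurn_one_basis e
  obtain ⟨t0, t1, -⟩ := diagonalTurn_basis e
  obtain ⟨i, j, k, rfl⟩ := hK.exists_word hm.ne' hg
  rw [mul_assoc] at hg
  have hg' := (Subgroup.mul_mem_cancel_left _
    (pow_mem (halfTurn_zero_mem_of_mixed hK hS) _)).1 hg
  obtain ⟨h1, h2⟩ := hS.image_eigenvector hg'
  have h3 := congrArg (fun x => ⟪e 2, x⟫_ℝ) (hg'.2.2 (e 1))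
  fin_cases j <;> fin_cases k <;>
    simp [pow_succ, t0, t1, q0, q1, q2, hS.s1, hd, inner_add_right,
      inner_smul_right, inner_basis, -inner_self_eq_norm_sq_to_K] at h1 h2 h3
  · fin_cases i <;> simp [p0]
  · exact absurd (by linarith) hd

/-- The four parameter cases correspond to four ways of showing that `e 0` is fixed: trace form,
kernel together with `S`, tetrahedral group together with `S`, and trace form again. The angle is
then limited by the weight two part of `K`, or by that of `S` when `m = 0`. -/
theorem stabilizer_formVIII (h : FormVIII e K S) :
    pairStabilizer K S = Subgroup.closure {halfTurn e 0} := by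
  obtain ⟨l, m, a, b, c, d, hcond, hK, hS⟩ := (formVIII_iff e K S).1 h
  have hP := halfTurn_zero_mem_of_mixed hK hS
  apply le_antisymm
  · intro g hg
    have hfix : g (e 0) = e 0 := by
      rcases hcond with ⟨hl, hm, hlm⟩ | ⟨rfl, hm, hne⟩ | ⟨rfl, hm, hd⟩ | ⟨rfl, hl, hne⟩
      · refine image_zero_of_mem_axisGroup hg (hK.mem_axisGroup hl.ne' (fun h => hlm ?_) hg)
          (hK.cubic_zero hl.ne')
        exact (pow_left_inj₀ hl.le hm.le two_ne_zero).1 h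
      · exact hK.image_zero_of_eq hm hS hne hg
      · exact hK.image_zero_of_zero hm hS hd hg
      · refine image_zero_of_mem_axisGroup hg (hK.mem_axisGroup hl.ne' ?_ hg)
          (hK.cubic_zero hl.ne')
        simpa using hl.ne'
    obtain ⟨θ, rfl⟩ := exists_eq_axisRotation e 0 hg.1 hfix
    have hsin : Real.sin θ = 0 := by
      by_cases hm : m = 0
      · refine hS.sin_eq_zero ?_ hg
        rcases hcond with ⟨-, hm', -⟩ | ⟨-, hm', -⟩ | ⟨-, hm', -⟩ | ⟨-, -, hne⟩
        · exact absurd hm hm'.ne'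
        · exact absurd hm hm'.ne'
        · exact absurd hm hm'.ne'
        · exact hne
      · exact hK.sin_eq_zero hm hg
    rcases axisRotation_eq_of_sin_eq_zero (e := e) hsin 0 with h | h <;> rw [h]
    · exact one_mem _
    · exact Subgroup.subset_closure rfl
  · rw [Subgroup.closure_le, Set.singleton_subset_iff]
    exact hP

end

/-! ### Isomorphism types -/

theorem closure_halfTurn_equiv (e : OrthonormalBasis (Fin 3) ℝ V) :
    Nonempty (Subgroup.closure {halfTurn e 0} ≃* Multiplicative (ZMod 2)) :=
  closure_equiv_zmod (by rw [sq, halfTurn_mul_self]) (halfTurn_ne_one e 0)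

theorem closure_thirdTurn_equiv (e : OrthonormalBasis (Fin 3) ℝ V) :
    Nonempty (Subgroup.closure {thirdTurn e 0} ≃* Multiplicative (ZMod 3)) :=
  closure_equiv_zmod (thirdTurn_pow_three e 0) (thirdTurn_ne_one e 0)

theorem closure_halfTurns_equiv (e : OrthonormalBasis (Fin 3) ℝ V) :
    Nonempty (Subgroup.closure {halfTurn e 0, halfTurn e 1} ≃*
      Multiplicative (ZMod 2) × Multiplicative (ZMod 2)) := by
  obtain ⟨p0, p1, p2⟩ := halfTurn_zero_basis e
  obtain ⟨q0, q1, q2⟩ := halfTurn_one_basis e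
  refine closure_equiv_klein (by rw [sq, halfTurn_mul_self]) (by rw [sq, halfTurn_mul_self]) ?_
    (halfTurn_ne_one e 0) (halfTurn_ne_one e 1) fun h => ?_
  · apply isometry_ext e <;> simp [p0, p1, p2, q0, q1, q2]
  · have h' := congrArg (fun g : V ≃ₗᵢ[ℝ] V => ⟪e 0, g (e 0)⟫_ℝ) h
    simp [p0, q0, inner_basis, -inner_self_eq_norm_sq_to_K] at h'
    norm_num at h'

theorem closure_halfTurn_thirdTurn_equiv (e : OrthonormalBasis (Fin 3) ℝ V) :
    Nonempty (Subgroup.closure {halfTurn e 0, thirdTurn e 2} ≃* Equiv.Perm (Fin 3)) := by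
  obtain ⟨p0, p1, p2⟩ := halfTurn_zero_basis e
  refine closure_equiv_perm_three (halfTurn_mul_self e 0) (thirdTurn_pow_three e 2) ?_
    (thirdTurn_ne_one e 2)
  rw [eq_inv_iff_mul_eq_one]
  have hc := Real.cos_sq_add_sin_sq (2 * π / 3)
  apply isometry_ext e <;> simp [p0, p1, p2, thirdTurn] <;> apply vector_ext e <;>
    simp [inner_add_right, inner_smul_right, inner_basis, -inner_self_eq_norm_sq_to_K] <;>
    linarith

/-- The stabilizer of each canonical form. -/
theorem stabilizer_canonical_forms (K : V →ₗ[ℝ] V →ₗ[ℝ] V) (S : V →ₗ[ℝ] V)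
    (e : OrthonormalBasis (Fin 3) ℝ V) :
      (FormI e K S →
        pairStabilizer K S = rotationGroup V ∧
        Nonempty (pairStabilizer K S ≃* Matrix.specialOrthogonalGroup (Fin 3) ℝ)) ∧
      (FormII e K S →
        pairStabilizer K S =
          Subgroup.closure (Set.range (axisRotation e 0) ∪ {halfTurn e 1}) ∧
        Nonempty (pairStabilizer K S ≃* Matrix.orthogonalGroup (Fin 2) ℝ)) ∧
      (FormIII e K S →
        (pairStabilizer K S : Set (V ≃ₗᵢ[ℝ] V)) = Set.range (axisRotation e 0) ∧
        Nonempty (pairStabilizer K S ≃* Matrix.specialOrthogonalGroup (Fin 2) ℝ)) ∧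
      (FormIV e K S →
        pairStabilizer K S =
          Subgroup.closure {halfTurn e 0, halfTurn e 1, diagonalTurn e} ∧
        Nonempty (pairStabilizer K S ≃* alternatingGroup (Fin 4))) ∧
      (FormV e K S →
        pairStabilizer K S = Subgroup.closure {halfTurn e 0, thirdTurn e 2} ∧
        Nonempty (pairStabilizer K S ≃* Equiv.Perm (Fin 3))) ∧
      (FormVI e K S →
        pairStabilizer K S = Subgroup.closure {halfTurn e 0, halfTurn e 1} ∧
        Nonempty (pairStabilizer K S ≃* Multiplicative (ZMod 2) × Multiplicative (ZMod 2))) ∧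
      (FormVII e K S →
        pairStabilizer K S = Subgroup.closure {thirdTurn e 0} ∧
        Nonempty (pairStabilizer K S ≃* Multiplicative (ZMod 3))) ∧
      (FormVIII e K S →
        pairStabilizer K S = Subgroup.closure {halfTurn e 0} ∧
        Nonempty (pairStabilizer K S ≃* Multiplicative (ZMod 2))) := by
  refine ⟨fun h => ⟨stabilizer_formI h, ?_⟩,
    fun h => ⟨(stabilizer_formII h).trans (axisGroup_eq_closure e), ?_⟩,
    fun h => ⟨stabilizer_formIII h, ?_⟩, fun h => ⟨stabilizer_formIV h, ?_⟩,
    fun h => ⟨stabilizer_formV h, ?_⟩, fun h => ⟨stabilizer_formVI h, ?_⟩,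
    fun h => ⟨stabilizer_formVII h, ?_⟩, fun h => ⟨stabilizer_formVIII h, ?_⟩⟩
  · rw [stabilizer_formI h]; exact rotationGroup_equiv e
  · rw [stabilizer_formII h]; exact axisGroup_equiv e
  · exact equiv_specialOrthogonalGroup_two e (mem_stabilizer_formIII h)
  · rw [stabilizer_formIV h]; exact closure_equiv_alternatingGroup e
  · rw [stabilizer_formV h]; exact closure_halfTurn_thirdTurn_equiv e
  · rw [stabilizer_formVI h]; exact closure_halfTurns_equiv e
  · rw [stabilizer_formVII h]; exact closure_thirdTurn_equiv e
  · rw [stabilizer_formVIII h]; exact closure_halfTurn_equiv e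

/-! ### Reduction to the canonical forms -/

/-- `K` and `S` have one of the canonical forms in some orthonormal basis. -/
def HasCanonicalForm (K : V →ₗ[ℝ] V →ₗ[ℝ] V) (S : V →ₗ[ℝ] V) : Prop :=
  ∃ e : OrthonormalBasis (Fin 3) ℝ V,
    FormI e K S ∨ FormII e K S ∨ FormIII e K S ∨ FormIV e K S ∨
    FormV e K S ∨ FormVI e K S ∨ FormVII e K S ∨ FormVIII e K S

theorem exists_cyclic_basis (e : OrthonormalBasis (Fin 3) ℝ V) :
    ∃ f : OrthonormalBasis (Fin 3) ℝ V, f 0 = e 1 ∧ f 1 = e 2 ∧ f 2 = e 0 :=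
  ⟨e.reindex (finRotate 3).symm, by simp [OrthonormalBasis.reindex_apply]⟩

section
variable {e : OrthonormalBasis (Fin 3) ℝ V} {K : V →ₗ[ℝ] V →ₗ[ℝ] V} {S : V →ₗ[ℝ] V}

theorem IsBlock.cyclic {a b c : ℝ} (hS : IsBlock e S a b c 0) {f : OrthonormalBasis (Fin 3) ℝ V}
    (h0 : f 0 = e 1) (h1 : f 1 = e 2) (h2 : f 2 = e 0) : IsBlock f S b c a 0 :=
  ⟨by simp [h0, hS.s1], by simp [h1, hS.s2], by simp [h2, hS.s0]⟩

/-- Only coincidences among the eigenvalues matter; if exactly two agree, a cyclic relabeling puts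
the third one first. -/
theorem hasCanonicalForm_of_diagonal {a b c : ℝ} (hK : K = 0) (hS : IsBlock e S a b c 0) :
    HasCanonicalForm K S := by
  obtain ⟨f, f0, f1, f2⟩ := exists_cyclic_basis e
  obtain ⟨f', f0', f1', f2'⟩ := exists_cyclic_basis f
  have hS' := hS.cyclic f0 f1 f2
  have hS'' := hS'.cyclic f0' f1' f2'
  have hII : ∀ {u : OrthonormalBasis (Fin 3) ℝ V} {x y : ℝ}, x ≠ y → IsBlock u S x y y 0 →
      HasCanonicalForm K S := fun {u x y} hxy hu =>
    ⟨u, Or.inr (Or.inl ((formII_iff u K S).2 ⟨x, y, hxy, hK, hu⟩))⟩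
  by_cases hbc : b = c
  · subst hbc
    by_cases hab : a = b
    · subst hab
      exact ⟨e, Or.inl ((formI_iff e K S).2 ⟨a, hK, hS⟩)⟩
    · exact hII hab hS
  by_cases hab : a = b
  · subst hab
    exact hII (Ne.symm hbc) hS''
  by_cases hac : a = c
  · subst hac
    exact hII (Ne.symm hab) hS'
  · refine ⟨e, ?_⟩
    iterate 5 right
    left
    refine (formVI_iff e K S).2 ⟨0, a, b, c, Or.inr ⟨rfl, hab, hbc, hac⟩, ?_, hS⟩
    subst hK
    constructor <;> simp

theorem hasCanonicalForm_of_zero (hV : Module.finrank ℝ V = 3) (hK : K = 0)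
    (hS : S.IsSymmetric) : HasCanonicalForm K S := by
  have : FiniteDimensional ℝ V := FiniteDimensional.of_finrank_pos (by omega)
  have h := hS.apply_eigenvectorBasis hV
  refine hasCanonicalForm_of_diagonal (e := hS.eigenvectorBasis hV)
    (a := hS.eigenvalues hV 0) (b := hS.eigenvalues hV 1) (c := hS.eigenvalues hV 2) hK
    ⟨?_, ?_, ?_⟩ <;> simp [h]

theorem IsMixed.eq_zero (hK : IsMixed e K 0 0) : K = 0 := by
  obtain ⟨k00, k01, k02, k10, k11, k12, k20, k21, k22⟩ := hK
  apply linearMap_ext e <;> apply linearMap_ext e <;> simp [*]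

theorem IsAxial.eq_zero (hK : IsAxial e K 0 0) : K = 0 := by
  obtain ⟨k00, k01, k02, k10, k11, k12, k20, k21, k22⟩ := hK
  apply linearMap_ext e <;> apply linearMap_ext e <;> simp [*]

theorem IsMixed.isAxial {l : ℝ} (hK : IsMixed e K l 0) : IsAxial e K l 0 := by
  obtain ⟨k00, k01, k02, k10, k11, k12, k20, k21, k22⟩ := hK
  constructor <;> simp [*]

/-- For `l = m` the cubic is `m x₀ (2 x₀² - 3 (x₁ - x₂)²)`. Turning by `-π/4` makes `e 1 + e 2` the
direction of the third basis vector, on which the cubic does not depend. -/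
theorem IsMixed.isPlanar {m : ℝ} (hK : IsMixed e K m m) :
    IsPlanar (rotatedBasis e 0 (-(π / 4))) K (2 * m) := by
  obtain ⟨k00, k01, k02, k10, k11, k12, k20, k21, k22⟩ := hK
  have h2 : √2 ^ 2 = (2 : ℝ) := Real.sq_sqrt (by norm_num)
  constructor <;> simp [k00, k01, k02, k10, k11, k12, k20, k21, k22] <;> apply vector_ext e <;>
    simp [inner_add_right, inner_smul_right, inner_basis, -inner_self_eq_norm_sq_to_K] <;> grind

/-- These are the blocks excluded in (viii) for `λ = μ`: `e 1 - e 2` has the same eigenvalue `a` as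
`e 0`, and `e 1 + e 2` has `a + 2 d`. -/
theorem IsBlock.rotate_eighth {a d : ℝ} (hS : IsBlock e S a (a + d) (a + d) d) :
    IsBlock (rotatedBasis e 0 (-(π / 4))) S a a (a + 2 * d) 0 := by
  obtain ⟨s0, s1, s2⟩ := hS
  constructor <;> simp [s0, s1, s2] <;> module

theorem hasCanonicalForm_of_mixed (hV : Module.finrank ℝ V = 3) (hSs : S.IsSymmetric)
    {l m a b c d : ℝ} (hl : 0 ≤ l) (hm : 0 ≤ m) (hK : IsMixed e K l m)
    (hS : IsBlock e S a b c d) : HasCanonicalForm K S := by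
  have hVIII : ((0 < l ∧ 0 < m ∧ l ≠ m) ∨
      (l = m ∧ 0 < m ∧ (b - c) ^ 2 + (b + c - 2 * a - 2 * d) ^ 2 ≠ 0) ∨
      (l = 0 ∧ 0 < m ∧ d ≠ 0) ∨
      (m = 0 ∧ 0 < l ∧ (b - c) ^ 2 + d ^ 2 ≠ 0)) → HasCanonicalForm K S := fun h => by
    refine ⟨e, ?_⟩
    iterate 7 right
    exact (formVIII_iff e K S).2 ⟨l, m, a, b, c, d, h, hK, hS⟩
  rcases hl.eq_or_lt with rfl | hl
  · rcases hm.eq_or_lt with rfl | hm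
    · exact hasCanonicalForm_of_zero hV hK.eq_zero hSs
    · by_cases hd : d = 0
      · subst hd
        by_cases habc : a = b ∧ b = c
        · obtain ⟨rfl, rfl⟩ := habc
          refine ⟨e, ?_⟩
          iterate 3 right
          exact Or.inl ((formIV_iff e K S).2 ⟨m, a, hm, hK, hS⟩)
        · refine ⟨e, ?_⟩
          iterate 5 right
          exact Or.inl ((formVI_iff e K S).2 ⟨m, a, b, c, Or.inl ⟨hm, habc⟩, hK, hS⟩)
      · exact hVIII (Or.inr (Or.inr (Or.inl ⟨rfl, hm, hd⟩)))
  · rcases hm.eq_or_lt with rfl | hm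
    · by_cases h : (b - c) ^ 2 + d ^ 2 = 0
      · have hd : d = 0 := by nlinarith [sq_nonneg (b - c), sq_nonneg d]
        have hbc : b = c := by nlinarith [sq_nonneg (b - c), sq_nonneg d]
        subst hd hbc
        refine ⟨e, ?_⟩
        iterate 2 right
        exact Or.inl ((formIII_iff e K S).2 ⟨l, a, b, hl, hK.isAxial, hS⟩)
      · exact hVIII (Or.inr (Or.inr (Or.inr ⟨rfl, hl, h⟩)))
    · by_cases hlm : l = m
      · subst hlm
        by_cases h : (b - c) ^ 2 + (b + c - 2 * a - 2 * d) ^ 2 = 0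
        · have hbc : b = c := by nlinarith [sq_nonneg (b - c), sq_nonneg (b + c - 2 * a - 2 * d)]
          subst hbc
          have hb : b = a + d := by nlinarith [sq_nonneg (b + b - 2 * a - 2 * d)]
          subst hb
          refine ⟨rotatedBasis e 0 (-(π / 4)), ?_⟩
          iterate 4 right
          exact Or.inl ((formV_iff _ K S).2
            ⟨2 * l, a, a + 2 * d, by linarith, hK.isPlanar, hS.rotate_eighth⟩)
        · exact hVIII (Or.inr (Or.inl ⟨rfl, hl, h⟩))
      · exact hVIII (Or.inl ⟨hl, hm, hlm⟩)

theorem IsAxial.isPlanar {m : ℝ} (hK : IsAxial e K 0 m) {f : OrthonormalBasis (Fin 3) ℝ V}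
    (h0 : f 0 = e 1) (h1 : f 1 = e 2) (h2 : f 2 = e 0) : IsPlanar f K m := by
  obtain ⟨k00, k01, k02, k10, k11, k12, k20, k21, k22⟩ := hK
  constructor <;> simp [*]

/-- The basis of the coordinate axes of the tetrahedron with vertex direction `e 0`. -/
theorem exists_tetrahedral_basis (e : OrthonormalBasis (Fin 3) ℝ V) {p q : ℝ}
    (hp : p ^ 2 = 1 / 3) (hq : q ^ 2 = 1 / 2) : ∃ f : OrthonormalBasis (Fin 3) ℝ V,
      f 0 = p • e 0 + (2 * p * q) • e 1 ∧ f 1 = p • e 0 + -(p * q) • e 1 + q • e 2 ∧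
      f 2 = p • e 0 + -(p * q) • e 1 + -q • e 2 := by
  have hv : Orthonormal ℝ ![p • e 0 + (2 * p * q) • e 1, p • e 0 + -(p * q) • e 1 + q • e 2,
      p • e 0 + -(p * q) • e 1 + -q • e 2] := by
    rw [orthonormal_iff_ite]
    intro i j
    fin_cases i <;> fin_cases j <;> simp [inner_add_left, inner_add_right, inner_smul_left,
      inner_smul_right, inner_basis, -inner_self_eq_norm_sq_to_K] <;> grind
  obtain ⟨f, hf⟩ := exists_basis_of_orthonormal e hv
  exact ⟨f, hf 0, hf 1, hf 2⟩

/-- At `m = √2 l` the line of `e 0` is a threefold axis of a tetrahedral cubic; the new basis lies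
symmetrically around it. The algebra uses only `p²` and `q²`, so the signs of the roots are free
here. -/
theorem IsAxial.isMixed {l p q : ℝ} (hp : p ^ 2 = 1 / 3) (hq : q ^ 2 = 1 / 2)
    (hK : IsAxial e K l (2 * q * l)) {f : OrthonormalBasis (Fin 3) ℝ V}
    (h0 : f 0 = p • e 0 + (2 * p * q) • e 1) (h1 : f 1 = p • e 0 + -(p * q) • e 1 + q • e 2)
    (h2 : f 2 = p • e 0 + -(p * q) • e 1 + -q • e 2) : IsMixed f K 0 (3 * p * l) := by
  obtain ⟨k00, k01, k02, k10, k11, k12, k20, k21, k22⟩ := hK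
  constructor <;> simp [h0, h1, h2, k00, k01, k02, k10, k11, k12, k20, k21, k22] <;>
    apply vector_ext e <;>
    simp [inner_add_right, inner_smul_right, inner_basis, -inner_self_eq_norm_sq_to_K] <;> grind

theorem hasCanonicalForm_of_axial (hV : Module.finrank ℝ V = 3) (hSs : S.IsSymmetric)
    {l m a b : ℝ} (hl : 0 ≤ l) (hm : 0 ≤ m) (hK : IsAxial e K l m)
    (hS : IsBlock e S a b b 0) : HasCanonicalForm K S := by
  have hVII : ((0 < l ∧ 0 < m ∧ m ≠ √2 * l) ∨ (m = √2 * l ∧ 0 < √2 * l ∧ a ≠ b)) →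
      HasCanonicalForm K S := fun h => by
    refine ⟨e, ?_⟩
    iterate 6 right
    exact Or.inl ((formVII_iff e K S).2 ⟨l, m, a, b, h, hK, hS⟩)
  rcases hm.eq_or_lt with rfl | hm
  · rcases hl.eq_or_lt with rfl | hl
    · exact hasCanonicalForm_of_zero hV hK.eq_zero hSs
    · refine ⟨e, ?_⟩
      iterate 2 right
      exact Or.inl ((formIII_iff e K S).2 ⟨l, a, b, hl, hK, hS⟩)
  · rcases hl.eq_or_lt with rfl | hl
    · obtain ⟨f, f0, f1, f2⟩ := exists_cyclic_basis e
      refine ⟨f, ?_⟩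
      iterate 4 right
      exact Or.inl ((formV_iff f K S).2
        ⟨m, b, a, hm, hK.isPlanar f0 f1 f2, hS.cyclic f0 f1 f2⟩)
    · by_cases hml : m = √2 * l
      · by_cases hab : a = b
        · subst hab hml
          -- The positive roots are taken, so that the new parameter `3 p l` is positive as form
          -- (iv) requires.
          have hp : (√3 / 3) ^ 2 = (1 / 3 : ℝ) := by
            rw [div_pow, Real.sq_sqrt (by norm_num)]; norm_num
          have hq : (√2 / 2) ^ 2 = (1 / 2 : ℝ) := by
            rw [div_pow, Real.sq_sqrt (by norm_num)]; norm_num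
          obtain ⟨f, f0, f1, f2⟩ := exists_tetrahedral_basis e hp hq
          have hid : S = a • LinearMap.id := linearMap_ext e (by simp [hS.s0]) (by simp [hS.s1])
            (by simp [hS.s2])
          have hKf := IsAxial.isMixed hp hq
            (by rwa [show 2 * (√2 / 2) * l = √2 * l by ring]) f0 f1 f2
          refine ⟨f, ?_⟩
          iterate 3 right
          exact Or.inl ((formIV_iff f K S).2 ⟨_, a, by positivity, hKf,
            ⟨by simp [hid], by simp [hid], by simp [hid]⟩⟩)
        · exact hVII (Or.inr ⟨hml, by positivity, hab⟩)
      · exact hVII (Or.inl ⟨hl, hm, hml⟩)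

end

/-! ### Symmetric apolar forms invariant under a rotation -/

/-- The coefficients of a totally symmetric apolar form. -/
structure IsCubic (e : OrthonormalBasis (Fin 3) ℝ V) (K : V →ₗ[ℝ] V →ₗ[ℝ] V)
    (c000 c001 c002 c011 c012 c111 c112 : ℝ) : Prop where
  k00 : K (e 0) (e 0) = c000 • e 0 + c001 • e 1 + c002 • e 2
  k01 : K (e 0) (e 1) = c001 • e 0 + c011 • e 1 + c012 • e 2
  k02 : K (e 0) (e 2) = c002 • e 0 + c012 • e 1 + (-c000 - c011) • e 2
  k10 : K (e 1) (e 0) = c001 • e 0 + c011 • e 1 + c012 • e 2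
  k11 : K (e 1) (e 1) = c011 • e 0 + c111 • e 1 + c112 • e 2
  k12 : K (e 1) (e 2) = c012 • e 0 + c112 • e 1 + (-c001 - c111) • e 2
  k20 : K (e 2) (e 0) = c002 • e 0 + c012 • e 1 + (-c000 - c011) • e 2
  k21 : K (e 2) (e 1) = c012 • e 0 + c112 • e 1 + (-c001 - c111) • e 2
  k22 : K (e 2) (e 2) = (-c000 - c011) • e 0 + (-c001 - c111) • e 1 + (-c002 - c112) • e 2

/-- Ten coefficients of a ternary cubic less three trace conditions leave seven. The first stays an
explicit inner product because the choice of axis controls its sign. -/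
theorem exists_isCubic (e : OrthonormalBasis (Fin 3) ℝ V) {K : V →ₗ[ℝ] V →ₗ[ℝ] V}
    (hK : IsSymmetricForm K) (hK0 : IsApolar K) :
    ∃ c001 c002 c011 c012 c111 c112,
      IsCubic e K ⟪K (e 0) (e 0), e 0⟫_ℝ c001 c002 c011 c012 c111 c112 := by
  have hs : ∀ i j k, ⟪e k, K (e i) (e j)⟫_ℝ = ⟪e j, K (e i) (e k)⟫_ℝ := fun i j k => by
    rw [real_inner_comm, hK.2, real_inner_comm]
  have hc : ∀ i j, K (e i) (e j) = K (e j) (e i) := fun i j => hK.1 _ _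
  have ht : ∀ i, ⟪e 0, K (e i) (e 0)⟫_ℝ + ⟪e 1, K (e i) (e 1)⟫_ℝ + ⟪e 2, K (e i) (e 2)⟫_ℝ = 0 := by
    intro i
    have h := hK0 (e i)
    rwa [LinearMap.trace_eq_sum_inner _ e, Fin.sum_univ_three] at h
  have t0 := ht 0
  have t1 := ht 1
  have t2 := ht 2
  rw [hc 1 0, hs 0 1 0] at t1
  rw [hc 2 0, hs 0 2 0, hc 2 1, hs 1 2 1] at t2
  have h02 : ⟪e 2, K (e 0) (e 2)⟫_ℝ = -⟪e 0, K (e 0) (e 0)⟫_ℝ - ⟪e 1, K (e 0) (e 1)⟫_ℝ := by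
    linarith
  have h12 : ⟪e 2, K (e 1) (e 2)⟫_ℝ = -⟪e 1, K (e 0) (e 0)⟫_ℝ - ⟪e 1, K (e 1) (e 1)⟫_ℝ := by
    linarith
  have h22 : ⟪e 2, K (e 2) (e 2)⟫_ℝ = -⟪e 2, K (e 0) (e 0)⟫_ℝ - ⟪e 2, K (e 1) (e 1)⟫_ℝ := by
    linarith
  have e01 : K (e 0) (e 1) = ⟪e 1, K (e 0) (e 0)⟫_ℝ • e 0 + ⟪e 1, K (e 0) (e 1)⟫_ℝ • e 1 +
      ⟪e 2, K (e 0) (e 1)⟫_ℝ • e 2 := by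
    rw [← hs 0 1 0]; exact expand e _
  have e02 : K (e 0) (e 2) = ⟪e 2, K (e 0) (e 0)⟫_ℝ • e 0 + ⟪e 2, K (e 0) (e 1)⟫_ℝ • e 1 +
      (-⟪e 0, K (e 0) (e 0)⟫_ℝ - ⟪e 1, K (e 0) (e 1)⟫_ℝ) • e 2 := by
    rw [← hs 0 2 0, ← hs 0 2 1, ← h02]; exact expand e _
  have e11 : K (e 1) (e 1) = ⟪e 1, K (e 0) (e 1)⟫_ℝ • e 0 + ⟪e 1, K (e 1) (e 1)⟫_ℝ • e 1 +
      ⟪e 2, K (e 1) (e 1)⟫_ℝ • e 2 := by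
    rw [hc 0 1, ← hs 1 1 0]; exact expand e _
  have e12 : K (e 1) (e 2) = ⟪e 2, K (e 0) (e 1)⟫_ℝ • e 0 + ⟪e 2, K (e 1) (e 1)⟫_ℝ • e 1 +
      (-⟪e 1, K (e 0) (e 0)⟫_ℝ - ⟪e 1, K (e 1) (e 1)⟫_ℝ) • e 2 := by
    rw [hc 0 1, ← hs 1 2 0, ← hs 1 2 1, ← h12]; exact expand e _
  have e22 : K (e 2) (e 2) = (-⟪e 0, K (e 0) (e 0)⟫_ℝ - ⟪e 1, K (e 0) (e 1)⟫_ℝ) • e 0 +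
      (-⟪e 1, K (e 0) (e 0)⟫_ℝ - ⟪e 1, K (e 1) (e 1)⟫_ℝ) • e 1 +
      (-⟪e 2, K (e 0) (e 0)⟫_ℝ - ⟪e 2, K (e 1) (e 1)⟫_ℝ) • e 2 := by
    rw [← h02, ← h12, ← h22, hc 0 2, hc 1 2, ← hs 2 2 0, ← hs 2 2 1]; exact expand e _
  refine ⟨⟪e 1, K (e 0) (e 0)⟫_ℝ, ⟪e 2, K (e 0) (e 0)⟫_ℝ, ⟪e 1, K (e 0) (e 1)⟫_ℝ,
    ⟪e 2, K (e 0) (e 1)⟫_ℝ, ⟪e 1, K (e 1) (e 1)⟫_ℝ, ⟪e 2, K (e 1) (e 1)⟫_ℝ, ?_⟩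
  rw [real_inner_comm]
  exact ⟨expand e _, e01, e02, (hc 1 0).trans e01, e11, e12, (hc 2 0).trans e02,
    (hc 2 1).trans e12, e22⟩

/-- Turning the complex number `B + iA` by minus its argument puts it on the nonnegative real axis.
-/
theorem exists_cos_sin_normalization (A B : ℝ) :
    ∃ θ, A * Real.cos θ + B * Real.sin θ = 0 ∧ 0 ≤ B * Real.cos θ - A * Real.sin θ := by
  have h1 := Complex.norm_mul_cos_arg ⟨B, A⟩
  have h2 := Complex.norm_mul_sin_arg ⟨B, A⟩
  have h3 := norm_nonneg (⟨B, A⟩ : ℂ)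
  simp only at h1 h2
  refine ⟨-Complex.arg ⟨B, A⟩, ?_, ?_⟩
  · rw [Real.cos_neg, Real.sin_neg]
    generalize Complex.arg ⟨B, A⟩ = φ at *
    generalize ‖(⟨B, A⟩ : ℂ)‖ = r at *
    rw [← h1, ← h2]; ring
  · rw [Real.cos_neg, Real.sin_neg]
    generalize Complex.arg ⟨B, A⟩ = φ at *
    generalize ‖(⟨B, A⟩ : ℂ)‖ = r at *
    have hc := Real.cos_sq_add_sin_sq φ
    rw [← h1, ← h2]
    calc (0 : ℝ) ≤ r := h3
      _ = r * (Real.cos φ ^ 2 + Real.sin φ ^ 2) := by rw [hc, mul_one]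
      _ = _ := by ring

/-- A plane rotation minus the identity has determinant `(c - 1)² + s² = 2 (1 - c)`, nonzero here.
-/
theorem eq_zero_of_rotation_fixed {c s x y : ℝ} (hcs : c ^ 2 + s ^ 2 = 1) (hc : c ≠ 1)
    (h1 : c * x - s * y = x) (h2 : s * x + c * y = y) : x = 0 ∧ y = 0 := by
  have hc' : 2 * (1 - c) ≠ 0 := mul_ne_zero two_ne_zero (sub_ne_zero.2 hc.symm)
  constructor
  · exact (mul_eq_zero.1 (by linear_combination (c - 1) * h1 + s * h2 - x * hcs :
      2 * (1 - c) * x = 0)).resolve_left hc'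
  · exact (mul_eq_zero.1 (by linear_combination (c - 1) * h2 - s * h1 - y * hcs :
      2 * (1 - c) * y = 0)).resolve_left hc'

section
variable {e : OrthonormalBasis (Fin 3) ℝ V} {K : V →ₗ[ℝ] V →ₗ[ℝ] V} {S : V →ₗ[ℝ] V}

/-- The component of `S (e 0)` in the plane is fixed by the rotation, hence zero; symmetry of `S`
clears the other off-block entries. -/
theorem IsBlock.of_rotation (hS : S.IsSymmetric) {θ : ℝ}
    (hg : axisRotation e 0 θ ∈ pairStabilizer K S) (hθ : Real.cos θ ≠ 1) :
    ∃ a b c d, IsBlock e S a b c d := by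
  have h1 := congrArg (fun x => ⟪e 1, x⟫_ℝ) (hg.2.2 (e 0))
  have h2 := congrArg (fun x => ⟪e 2, x⟫_ℝ) (hg.2.2 (e 0))
  rw [axisRotation_basis, rotatedFrame_self] at h1 h2
  have hexp := expand e (S (e 0))
  have hg0 : axisRotation e 0 θ (S (e 0)) = axisRotation e 0 θ (⟪e 0, S (e 0)⟫_ℝ • e 0 +
      ⟪e 1, S (e 0)⟫_ℝ • e 1 + ⟪e 2, S (e 0)⟫_ℝ • e 2) := by rw [← hexp]
  rw [hg0] at h1 h2
  simp [inner_add_right, inner_smul_right, inner_basis, -inner_self_eq_norm_sq_to_K] at h1 h2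
  obtain ⟨h01, h02⟩ := eq_zero_of_rotation_fixed (Real.cos_sq_add_sin_sq θ) hθ
    (by linarith : Real.cos θ * ⟪e 1, S (e 0)⟫_ℝ - Real.sin θ * ⟪e 2, S (e 0)⟫_ℝ = _)
    (by linarith)
  have hsymm : ∀ i j, ⟪e i, S (e j)⟫_ℝ = ⟪e j, S (e i)⟫_ℝ := fun i j => by
    rw [← hS, real_inner_comm]
  refine ⟨⟪e 0, S (e 0)⟫_ℝ, ⟪e 1, S (e 1)⟫_ℝ, ⟪e 2, S (e 2)⟫_ℝ, ⟪e 2, S (e 1)⟫_ℝ, ?_, ?_, ?_⟩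
  · conv_lhs => rw [hexp, h01, h02]
    simp
  · conv_lhs => rw [expand e (S (e 1)), hsymm 0 1, h01]
    simp
  · conv_lhs => rw [expand e (S (e 2)), hsymm 0 2, h02, hsymm 1 2]
    simp

/-- The weight two part of `S` vanishes unless the rotation is a half-turn. -/
theorem IsBlock.scalar_of_rotation {a b c d : ℝ} (hS : IsBlock e S a b c d) {θ : ℝ}
    (hg : axisRotation e 0 θ ∈ pairStabilizer K S) (hθ : Real.sin θ ≠ 0) : c = b ∧ d = 0 := by
  have h : (b - c) ^ 2 + d ^ 2 = 0 := by
    by_contra h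
    exact hθ (hS.sin_eq_zero h hg)
  constructor <;> nlinarith [sq_nonneg (b - c), sq_nonneg d]

theorem IsBlock.rotate {a b c d : ℝ} (hS : IsBlock e S a b c d) (φ : ℝ) :
    ∃ b' c' d', IsBlock (rotatedBasis e 0 φ) S a b' c' d' := by
  obtain ⟨s0, s1, s2⟩ := hS
  have hc := Real.cos_sq_add_sin_sq φ
  refine ⟨b * Real.cos φ ^ 2 + 2 * d * Real.cos φ * Real.sin φ + c * Real.sin φ ^ 2,
    b * Real.sin φ ^ 2 - 2 * d * Real.cos φ * Real.sin φ + c * Real.cos φ ^ 2,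
    (c - b) * Real.cos φ * Real.sin φ + d * (Real.cos φ ^ 2 - Real.sin φ ^ 2), ?_, ?_, ?_⟩ <;>
    simp [s0, s1, s2] <;> apply vector_ext e <;>
    simp [inner_add_right, inner_smul_right, inner_basis, -inner_self_eq_norm_sq_to_K] <;> grind

theorem IsBlock.rotate_scalar {a b : ℝ} (hS : IsBlock e S a b b 0) (φ : ℝ) :
    IsBlock (rotatedBasis e 0 φ) S a b b 0 := by
  obtain ⟨s0, s1, s2⟩ := hS
  constructor <;> simp [s0, s1, s2] <;> module

theorem IsCubic.weight_one {c000 c001 c002 c011 c012 c111 c112 : ℝ}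
    (hK : IsCubic e K c000 c001 c002 c011 c012 c111 c112) {θ : ℝ}
    (hg : axisRotation e 0 θ ∈ pairStabilizer K S) (hθ : Real.cos θ ≠ 1) :
    c001 = 0 ∧ c002 = 0 := by
  have h := hg.2.1 (e 0) (e 0)
  have h1 := congrArg (fun x => ⟪e 1, x⟫_ℝ) h
  have h2 := congrArg (fun x => ⟪e 2, x⟫_ℝ) h
  simp [hK.k00, inner_add_right, inner_smul_right, inner_basis,
    -inner_self_eq_norm_sq_to_K] at h1 h2
  exact eq_zero_of_rotation_fixed (Real.cos_sq_add_sin_sq θ) hθ (by linarith) (by linarith)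

/-- The traceless part of `K_{e₀}` on the plane must commute with a rotation other than ±1, so it
vanishes. -/
theorem IsCubic.weight_two {c000 c001 c002 c011 c012 c111 c112 : ℝ}
    (hK : IsCubic e K c000 c001 c002 c011 c012 c111 c112) {θ : ℝ}
    (hg : axisRotation e 0 θ ∈ pairStabilizer K S) (hθ : Real.sin θ ≠ 0) :
    c011 = -(c000 / 2) ∧ c012 = 0 := by
  have h := hg.2.1 (e 0) (e 1)
  have h1 := congrArg (fun x => ⟪e 1, x⟫_ℝ) h
  have h2 := congrArg (fun x => ⟪e 2, x⟫_ℝ) h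
  simp [hK.k01, hK.k02, inner_add_right, inner_smul_right, inner_basis,
    -inner_self_eq_norm_sq_to_K] at h1 h2
  constructor
  · exact mul_left_cancel₀ hθ (by linarith)
  · exact mul_left_cancel₀ hθ (by linarith)

theorem IsCubic.weight_three {c000 c001 c002 c011 c012 c111 c112 : ℝ}
    (hK : IsCubic e K c000 c001 c002 c011 c012 c111 c112)
    (hg : halfTurn e 0 ∈ pairStabilizer K S) : c111 = 0 ∧ c112 = 0 := by
  obtain ⟨p0, p1, p2⟩ := halfTurn_zero_basis e
  have h := hg.2.1 (e 1) (e 1)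
  have h1 := congrArg (fun x => ⟪e 1, x⟫_ℝ) h
  have h2 := congrArg (fun x => ⟪e 2, x⟫_ℝ) h
  simp [p0, p1, p2, hK.k11, inner_add_right, inner_smul_right, inner_basis,
    -inner_self_eq_norm_sq_to_K] at h1 h2
  constructor <;> linarith

theorem IsCubic.exists_isMixed {c000 c011 c012 : ℝ}
    (hK : IsCubic e K c000 0 0 c011 c012 0 0) :
    ∃ φ m, 0 ≤ m ∧ IsMixed (rotatedBasis e 0 φ) K (c000 / 2) m := by
  obtain ⟨k00, k01, k02, k10, k11, k12, k20, k21, k22⟩ := hK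
  -- The arguments are the difference of the diagonal entries and twice the off-diagonal entry of
  -- `K_{e₀}` on the plane. This weight two pair turns by `2φ` when the basis turns by `φ`.
  obtain ⟨θ, h1, h2⟩ := exists_cos_sin_normalization (2 * c011 + c000) (2 * c012)
  obtain ⟨φ, rfl⟩ : ∃ φ, θ = 2 * φ := ⟨θ / 2, by ring⟩
  rw [Real.cos_two_mul, Real.sin_two_mul] at h1 h2
  refine ⟨φ, _, div_nonneg h2 zero_le_two, ?_⟩
  have hc := Real.cos_sq_add_sin_sq φ
  clear h2
  constructor <;> simp [k00, k01, k02, k10, k11, k12, k20, k21, k22] <;> apply vector_ext e <;>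
    simp [inner_add_right, inner_smul_right, inner_basis, -inner_self_eq_norm_sq_to_K] <;> grind

theorem IsCubic.exists_isAxial {c000 c111 c112 : ℝ}
    (hK : IsCubic e K c000 0 0 (-(c000 / 2)) 0 c111 c112) :
    ∃ φ m, 0 ≤ m ∧ IsAxial (rotatedBasis e 0 φ) K (c000 / 2) m := by
  obtain ⟨k00, k01, k02, k10, k11, k12, k20, k21, k22⟩ := hK
  -- The pair `(c111, c112)` has weight three, so the basis is turned by a third of the normalizing
  -- angle.
  obtain ⟨θ, h1, h2⟩ := exists_cos_sin_normalization (-c112) c111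
  obtain ⟨φ, rfl⟩ : ∃ φ, θ = 3 * φ := ⟨θ / 3, by ring⟩
  rw [Real.cos_three_mul, Real.sin_three_mul] at h1 h2
  refine ⟨φ, _, h2, ?_⟩
  have hc := Real.cos_sq_add_sin_sq φ
  clear h2
  constructor <;> simp [k00, k01, k02, k10, k11, k12, k20, k21, k22] <;> apply vector_ext e <;>
    simp [inner_add_right, inner_smul_right, inner_basis, -inner_self_eq_norm_sq_to_K] <;> grind

end

/-! ### The axis of a rotation -/

theorem exists_fixed_vector (e : OrthonormalBasis (Fin 3) ℝ V) {g : V ≃ₗᵢ[ℝ] V}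
    (hg : g ∈ rotationGroup V) : ∃ v : V, ‖v‖ = 1 ∧ g v = v := by
  have hO := (Matrix.mem_orthogonalGroup_iff' (Fin 3) ℝ).1 (frameMatrix_mem_orthogonalGroup e g)
  have hd := (mem_rotationGroup_iff e g).1 hg
  set M := frameMatrix e g
  have hdet : (M - 1).det = 0 := by
    -- Taking determinants gives `det (M - 1) = (-1)³ det (M - 1)`: in odd dimension a rotation has
    -- eigenvalue 1.
    have h1 : M.transpose * (M - 1) = -(M - 1).transpose := by
      rw [mul_sub, mul_one, Matrix.transpose_sub, Matrix.transpose_one, neg_sub]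
      congr 1
    have h2 := congrArg Matrix.det h1
    rw [Matrix.det_mul, Matrix.det_transpose, hd, one_mul, Matrix.det_neg,
      Matrix.det_transpose] at h2
    norm_num at h2
    linarith
  obtain ⟨x, hx0, hx⟩ := Matrix.exists_mulVec_eq_zero_iff.2 hdet
  rw [Matrix.sub_mulVec, Matrix.one_mulVec, sub_eq_zero] at hx
  let w : V := x 0 • e 0 + x 1 • e 1 + x 2 • e 2
  have hw : ∀ i, ⟪e i, w⟫_ℝ = x i := fun i => by
    fin_cases i <;> simp [w, inner_add_right, inner_smul_right, inner_basis,
      -inner_self_eq_norm_sq_to_K]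
  have hgw : ∀ i, ⟪e i, g w⟫_ℝ = x i := fun i => by
    have h := congrFun hx i
    rw [Matrix.mulVec, dotProduct, Fin.sum_univ_three] at h
    simp only [M, frameMatrix_apply] at h
    simp only [w, map_add, map_smul, inner_add_right, inner_smul_right]
    linarith
  have hfix : g w = w :=
    vector_ext e ((hgw 0).trans (hw 0).symm) ((hgw 1).trans (hw 1).symm)
      ((hgw 2).trans (hw 2).symm)
  have hw0 : w ≠ 0 := fun h => hx0 (funext fun i => by rw [← hw i, h, inner_zero_right]; rfl)
  exact ⟨(‖w‖⁻¹ : ℝ) • w, by rw [norm_smul, norm_inv, norm_norm, inv_mul_cancel₀ (by simpa)],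
    by rw [map_smul, hfix]⟩

/-- A rotation has an adapted basis in which the cubic form is nonnegative on the axis. -/
theorem exists_adapted_basis (hV : Module.finrank ℝ V = 3) (K : V →ₗ[ℝ] V →ₗ[ℝ] V)
    {g : V ≃ₗᵢ[ℝ] V} (hg : g ∈ rotationGroup V) : ∃ e : OrthonormalBasis (Fin 3) ℝ V,
      g (e 0) = e 0 ∧ 0 ≤ ⟪K (e 0) (e 0), e 0⟫_ℝ := by
  have : FiniteDimensional ℝ V := FiniteDimensional.of_finrank_pos (by omega)
  let b : OrthonormalBasis (Fin 3) ℝ V := (stdOrthonormalBasis ℝ V).reindex (finCongr hV)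
  -- The cubic form is odd, so one of `v` and `-v` has a nonnegative value.
  obtain ⟨v, hv, hgv, hpos⟩ : ∃ v : V, ‖v‖ = 1 ∧ g v = v ∧ 0 ≤ ⟪K v v, v⟫_ℝ := by
    obtain ⟨v, hv, hgv⟩ := exists_fixed_vector b hg
    rcases le_total 0 ⟪K v v, v⟫_ℝ with h | h
    · exact ⟨v, hv, hgv, h⟩
    · exact ⟨-v, by rwa [norm_neg], by rw [map_neg, hgv], by simpa using h⟩
  obtain ⟨e, he⟩ := Orthonormal.exists_orthonormalBasis_extension_of_card_eq
    (𝕜 := ℝ) (ι := Fin 3) (by simpa using hV) (v := fun _ => v) (s := {0}) (by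
      rw [orthonormal_iff_ite]
      rintro ⟨i, rfl⟩ ⟨j, rfl⟩
      simp [hv])
  have he0 : e 0 = v := he 0 rfl
  exact ⟨e, by rw [he0, hgv], by rwa [he0]⟩

theorem hasCanonicalForm_of_nontrivial (hV : Module.finrank ℝ V = 3) {S : V →ₗ[ℝ] V}
    (hS : S.IsSymmetric) {K : V →ₗ[ℝ] V →ₗ[ℝ] V} (hK : IsSymmetricForm K) (hK0 : IsApolar K)
    (hne : pairStabilizer K S ≠ ⊥) : HasCanonicalForm K S := by
  obtain ⟨⟨g, hg⟩, hg1'⟩ := Subgroup.ne_bot_iff_exists_ne_one.1 hne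
  have hg1 : g ≠ 1 := fun h => hg1' (Subtype.ext h)
  obtain ⟨e, he, hpos⟩ := exists_adapted_basis hV K hg.1
  obtain ⟨θ, rfl⟩ := exists_eq_axisRotation e 0 hg.1 he
  have hcos : Real.cos θ ≠ 1 := fun hc => by
    have hs := Real.cos_sq_add_sin_sq θ
    rw [hc] at hs
    have hs0 : Real.sin θ = 0 := by
      apply pow_eq_zero_iff two_ne_zero |>.1; linarith
    exact hg1 (by apply isometry_ext e <;> simp [hc, hs0])
  obtain ⟨c001, c002, c011, c012, c111, c112, hC⟩ := exists_isCubic e hK hK0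
  obtain ⟨a, b, c, d, hB⟩ := IsBlock.of_rotation hS hg hcos
  obtain ⟨rfl, rfl⟩ := hC.weight_one hg hcos
  -- Half-turns keep weight two and lose weight three. All other angles lose weight two; that weight
  -- three survives only for thirds of a turn is not needed.
  by_cases hsin : Real.sin θ = 0
  · rw [(axisRotation_eq_of_sin_eq_zero hsin 0).resolve_left hg1] at hg
    obtain ⟨rfl, rfl⟩ := hC.weight_three hg
    obtain ⟨φ, m, hm, hM⟩ := hC.exists_isMixed
    obtain ⟨b', c', d', hB'⟩ := hB.rotate φ
    exact hasCanonicalForm_of_mixed hV hS (div_nonneg hpos zero_le_two) hm hM hB'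
  · obtain ⟨rfl, rfl⟩ := hC.weight_two hg hsin
    obtain ⟨rfl, rfl⟩ := hB.scalar_of_rotation hg hsin
    obtain ⟨φ, m, hm, hA⟩ := hC.exists_isAxial
    exact hasCanonicalForm_of_axial hV hS (div_nonneg hpos zero_le_two) hm hA (hB.rotate_scalar φ)

end CubicShape

open CubicShape in
theorem theorem2p2 {V : Type*} [NormedAddCommGroup V] [InnerProductSpace ℝ V]
    (hV : Module.finrank ℝ V = 3)
    (S : V →ₗ[ℝ] V) (hS : S.IsSymmetric)
    (K : V →ₗ[ℝ] V →ₗ[ℝ] V) (hK : IsSymmetricForm K) (hK0 : IsApolar K) :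
    -- the isomorphism types of nontrivial stabilizers, and the canonical forms
    (pairStabilizer K S ≠ ⊥ →
      (Nonempty (pairStabilizer K S ≃* Matrix.specialOrthogonalGroup (Fin 3) ℝ) ∨
        Nonempty (pairStabilizer K S ≃* Matrix.orthogonalGroup (Fin 2) ℝ) ∨
        Nonempty (pairStabilizer K S ≃* Matrix.specialOrthogonalGroup (Fin 2) ℝ) ∨
        Nonempty (pairStabilizer K S ≃* alternatingGroup (Fin 4)) ∨
        Nonempty (pairStabilizer K S ≃* Equiv.Perm (Fin 3)) ∨
        Nonempty (pairStabilizer K S ≃* Multiplicative (ZMod 2) × Multiplicative (ZMod 2)) ∨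
        Nonempty (pairStabilizer K S ≃* Multiplicative (ZMod 3)) ∨
        Nonempty (pairStabilizer K S ≃* Multiplicative (ZMod 2))) ∧
      ∃ e : OrthonormalBasis (Fin 3) ℝ V,
        FormI e K S ∨ FormII e K S ∨ FormIII e K S ∨ FormIV e K S ∨
        FormV e K S ∨ FormVI e K S ∨ FormVII e K S ∨ FormVIII e K S) ∧
    -- the stabilizer of each canonical form
    ∀ e : OrthonormalBasis (Fin 3) ℝ V,
      (FormI e K S →
        pairStabilizer K S = rotationGroup V ∧
        Nonempty (pairStabilizer K S ≃* Matrix.specialOrthogonalGroup (Fin 3) ℝ)) ∧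
      (FormII e K S →
        pairStabilizer K S =
          Subgroup.closure (Set.range (axisRotation e 0) ∪ {halfTurn e 1}) ∧
        Nonempty (pairStabilizer K S ≃* Matrix.orthogonalGroup (Fin 2) ℝ)) ∧
      (FormIII e K S →
        (pairStabilizer K S : Set (V ≃ₗᵢ[ℝ] V)) = Set.range (axisRotation e 0) ∧
        Nonempty (pairStabilizer K S ≃* Matrix.specialOrthogonalGroup (Fin 2) ℝ)) ∧
      (FormIV e K S →
        pairStabilizer K S =
          Subgroup.closure {halfTurn e 0, halfTurn e 1, diagonalTurn e} ∧
        Nonempty (pairStabilizer K S ≃* alternatingGroup (Fin 4))) ∧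
      (FormV e K S →
        pairStabilizer K S = Subgroup.closure {halfTurn e 0, thirdTurn e 2} ∧
        Nonempty (pairStabilizer K S ≃* Equiv.Perm (Fin 3))) ∧
      (FormVI e K S →
        pairStabilizer K S = Subgroup.closure {halfTurn e 0, halfTurn e 1} ∧
        Nonempty (pairStabilizer K S ≃* Multiplicative (ZMod 2) × Multiplicative (ZMod 2))) ∧
      (FormVII e K S →
        pairStabilizer K S = Subgroup.closure {thirdTurn e 0} ∧
        Nonempty (pairStabilizer K S ≃* Multiplicative (ZMod 3))) ∧
      (FormVIII e K S →
        pairStabilizer K S = Subgroup.closure {halfTurn e 0} ∧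
        Nonempty (pairStabilizer K S ≃* Multiplicative (ZMod 2))) := by
  have hforms := stabilizer_canonical_forms K S
  refine ⟨fun hne => ?_, hforms⟩
  obtain ⟨e, he⟩ := hasCanonicalForm_of_nontrivial hV hS hK hK0 hne
  refine ⟨?_, e, he⟩
  -- The list of isomorphism types follows from the stabilizers of the canonical forms, applied in
  -- the basis just found.
  obtain ⟨f1, f2, f3, f4, f5, f6, f7, f8⟩ := hforms e
  exact he.imp (fun h => (f1 h).2) <| Or.imp (fun h => (f2 h).2) <| Or.imp (fun h => (f3 h).2) <|
    Or.imp (fun h => (f4 h).2) <| Or.imp (fun h => (f5 h).2) <| Or.imp (fun h => (f6 h).2) <|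
    Or.imp (fun h => (f7 h).2) (fun h => (f8 h).2)
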